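/- **Theorem 4 (Bootstrap justification).** Let $T\ge 4$, $\tau\in\{1,\dots,T\}$, $\sigma>0$, and for each $N$ let $$Y_{i,t}=\mu_i+\delta_i\,\mathbf 1\{t>\tau\}+\sigma\varepsilon_{i,t},\qquad 1\le i\le N,\ 1\le t\le T,$$ where the $\mu_i,\delta_i$ are arbitrary real numbers (the $\delta_i$ may depend on $N$). No condition is imposed on $\tau$ and the $\delta_i$, so both $H_0$ ($\tau=T$, no change) and $H_1$ ($\tau<T$ and some $\delta_i\ne0$) are covered. Assume that the vectors $(\varepsilon_{i,1},\dots,\varepsilon_{i,T})$, $i\in\mathbb N$, are iid on a probability space $(\Omega,\mathcal F,\mathsf P)$ with $\mathsf E\varepsilon_{i,t}=0$, $\operatorname{Var}\varepsilon_{i,t}=1$, $\mathsf E\varepsilon_{1,t}^4<\infty$ and $\operatorname{Cov}(\varepsilon_{i,s},\varepsilon_{i,s+t})=\rho_t$ independent of $s$. Put $\rho_{-t}=\rho_t$ and $$r(t)=\sum_{|s|<t}(t-|s|)\rho_s,\qquad S(t,v,d)=\sum_{s=1}^t\sum_{u=t+d}^v\rho_{u-s},\qquad R(t,v)=S(t,v,1)$$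 (empty sums are $0$). Let $\widehat\tau_N\in\{1,\dots,T\}$ be a measurable function of the data $\mathbb Y=\mathbb Y_N=\{Y_{i,t}\}_{i\le N,\,t\le T}$ with $\lim_{N\to\infty}\mathsf P[\widehat\tau_N=\tau]=1$. For a panel $y=(y_{i,t})_{i\le N,t\le T}$ write $\bar y_{i,t}=\frac1t\sum_{s=1}^ty_{i,s}$ and $\widetilde y_{i,t}=\frac1{T-t}\sum_{s=t+1}^Ty_{i,s}$. The residuals are $\widehat e_{i,t}=Y_{i,t}-\bar Y_{i,\widehat\tau_N}$ for $t\le\widehat\tau_N$ and $\widehat e_{i,t}=Y_{i,t}-\widetilde Y_{i,\widehat\tau_N}$ for $t>\widehat\tau_N$. Let the rows $(\widehat e^*_{i,1},\dots,\widehat e^*_{i,T})$, $i=1,\dots,N$, be drawn with replacement from the $N$ rows $(\widehat e_{i,1},\dots,\widehat e_{i,T})$ (the drawn row numbers are iid uniform on $\{1,\dots,N\}$ and independent of $\mathbb Y$), let $\widehat Y^*_{i,t}=\widehat e^*_{i,t}-\frac1N\sum_{l=1}^N\widehat e_{l,t}$, and let $\mathcal R^*_N(T)$ be the value at $y=\widehat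 Y^*$ of $$\max_{t=2,\dots,T-2}\frac{\max_{s=1,\dots,t}\bigl|\sum_{i=1}^N\sum_{q=1}^s(y_{i,q}-\bar y_{i,t})\bigr|}{\max_{s=t,\dots,T-1}\bigl|\sum_{i=1}^N\sum_{q=s+1}^T(y_{i,q}-\widetilde y_{i,t})\bigr|}.$$ A quotient with denominator $0$ is read as $0$, here and in the limit below. Define the symmetric $T\times T$ matrix $\Gamma=\Gamma(\tau)=(\gamma_{t,v}(\tau))$ by $$\gamma_{t,t}(\tau)=\begin{cases}r(t)+\frac{t^2}{\tau^2}r(\tau)-\frac{2t}{\tau}[r(t)+R(t,\tau)],&t<\tau,\\ 0,&t=\tau,\\ r(t-\tau)+\frac{(t-\tau)^2}{(T-\tau)^2}r(T-\tau)-\frac{2(t-\tau)}{T-\tau}[r(t-\tau)+R(t-\tau,T-\tau)],&t>\tau,\end{cases}$$ and, for $t<v$, $$\gamma_{t,v}(\tau)=\begin{cases}0,&t=\tau\text{ or }v=\tau,\\ r(t)+R(t,v)+\frac{tv}{\tau^2}r(\tau)-\frac v\tau[r(t)+R(t,\tau)]-\frac t\tau[r(v)+R(v,\tau)],&t<v<\tau,\\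 S(t,v,\tau+1-t)+\frac{t(v-\tau)}{\tau(T-\tau)}R(\tau,T)-\frac{v-\tau}{T-\tau}S(t,T,\tau+1-t)-\frac t\tau R(\tau,v),&t<\tau<v,\\ r(t-\tau)+R(t-\tau,v-\tau)+\frac{(t-\tau)(v-\tau)}{(T-\tau)^2}r(T-\tau)-\frac{v-\tau}{T-\tau}[r(t-\tau)+R(t-\tau,T-\tau)]-\frac{t-\tau}{T-\tau}[r(v-\tau)+R(v-\tau,T-\tau)],&\tau<t<v.\end{cases}$$ Then $\Gamma$ is positive semidefinite and, conditionally on $\mathbb Y$, as $N\to\infty$, $\mathcal R^*_N(T)$ converges in distribution, in $\mathsf P$-probability, to $$\mathcal L:=\max_{t=2,\dots,T-2}\frac{\max_{s=1,\dots,t}\left|\mathcal X_s-\frac st\mathcal X_t\right|}{\max_{s=t,\dots,T-1}\left|\mathcal Z_s-\frac{T-s}{T-t}\mathcal Z_t\right|},\qquad \mathcal Z_t:=\mathcal X_T-\mathcal X_t,$$ where $(\mathcal X_1,\dots,\mathcal X_T)$ is a centred Gaussian vector with covariance matrix $\Gamma$. That is, for every bounded continuous $f:\mathbb R\to\mathbb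 R$, $\mathsf E[f(\mathcal R^*_N(T))\mid\mathbb Y_N]\to\mathsf E f(\mathcal L)$ in $\mathsf P$-probability. -/

import Mathlib

open MeasureTheory ProbabilityTheory Filter Topology
open scoped ENNReal BoundedContinuousFunction

namespace PanelChange

noncomputable section

/-- The time points `1, …, T`. -/
abbrev Time (T : ℕ) : Type := ↥(Finset.Icc 1 T)

/-- A panel data set: `N` rows (panels), each observed at the times `1, …, T`. -/
abbrev Panel (N T : ℕ) : Type := Fin N → Time T → ℝ

/-- The entry of a row at time `t`, as a function of a natural number `t`; the value `0` outside
`1, …, T` is never used below for `1 ≤ t ≤ T`. -/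
def obs {T : ℕ} (x : Time T → ℝ) (t : ℕ) : ℝ :=
  if h : t ∈ Finset.Icc 1 T then x ⟨t, h⟩ else 0

/-- The maximum of `f` over a finite set of indices (`0` for the empty set). -/
def maxOver (s : Finset ℕ) (f : ℕ → ℝ) : ℝ :=
  if h : s.Nonempty then s.sup' h f else 0

/-- The average of the first `t` observations of a row. -/
def headMean {T : ℕ} (x : Time T → ℝ) (t : ℕ) : ℝ :=
  (1 / (t : ℝ)) * ∑ s ∈ Finset.Icc 1 t, obs x s

/-- The average of the last `T - t` observations of a row. -/
def tailMean {T : ℕ} (x : Time T → ℝ) (t : ℕ) : ℝ :=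
  (1 / ((T : ℝ) - (t : ℝ))) * ∑ s ∈ Finset.Icc (t + 1) T, obs x s

/-- The ratio type statistic of a panel data set. -/
def ratioStat {N T : ℕ} (y : Panel N T) : ℝ :=
  maxOver (Finset.Icc 2 (T - 2)) fun t =>
    maxOver (Finset.Icc 1 t)
        (fun s => |∑ i, ∑ q ∈ Finset.Icc 1 s, (obs (y i) q - headMean (y i) t)|) /
      maxOver (Finset.Icc t (T - 1))
        (fun s => |∑ i, ∑ q ∈ Finset.Icc (s + 1) T, (obs (y i) q - tailMean (y i) t)|)

/-- The residuals of a panel data set for the (estimated) change point `k`. -/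
def residual {N T : ℕ} (k : Time T) (y : Panel N T) : Panel N T := fun i t =>
  if t ≤ k then y i t - headMean (y i) (k : ℕ) else y i t - tailMean (y i) (k : ℕ)

/-- The bootstrap panel obtained from the residuals `e` by taking row `j i` as the `i`-th row and
centring with the column averages of `e`. -/
def bootPanel {N T : ℕ} (e : Panel N T) (j : Fin N → Fin N) : Panel N T := fun i t =>
  e (j i) t - (1 / (N : ℝ)) * ∑ l, e l t

/-- The bootstrap statistic of the data `y` for the change point estimator `tauHat` and the
resampled row labels `j`. -/
def bootStat {N T : ℕ} (tauHat : Panel N T → Time T) (y : Panel N T) (j : Fin N → Fin N) : ℝ :=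
  ratioStat (bootPanel (residual (tauHat y) y) j)

/-- The panel change point model with `N` panels: means `μ i`, breaks `δ i` after time `τ`,
scale `σ`, and error vectors `ε i`. -/
def panelData {Ω : Type*} {T : ℕ} (μ δ : ℕ → ℝ) (σ : ℝ) (τ : Time T)
    (ε : ℕ → Ω → Time T → ℝ) (N : ℕ) (ω : Ω) : Panel N T := fun i t =>
  μ i + (if τ < t then δ i else 0) + σ * ε i ω t

/-- The error vectors are iid over the panels, with centred entries of unit variance and with
autocorrelation function `ρ` depending on the lag only. -/
structure IsErrorArray {Ω : Type*} [MeasurableSpace Ω] (P : Measure Ω) {T : ℕ}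
    (ε : ℕ → Ω → Time T → ℝ) (ρ : ℕ → ℝ) : Prop where
  measurable : ∀ i, Measurable (ε i)
  indep : iIndepFun ε P
  identDistrib : ∀ i, IdentDistrib (ε i) (ε 0) P P
  mean_zero : ∀ i t, ∫ ω, ε i ω t ∂P = 0
  var_one : ∀ i t, variance (fun ω => ε i ω t) P = 1
  cov_eq : ∀ i (s u : Time T), s ≤ u →
    covariance (fun ω => ε i ω s) (fun ω => ε i ω u) P = ρ ((u : ℕ) - (s : ℕ))

/-- The labels `J 0, …, J (N - 1)` of `N` rows drawn with replacement from the rows of the data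
set `Y`: iid, uniform, and independent of the data. -/
structure IsResampling {Ω : Type*} [MeasurableSpace Ω] (P : Measure Ω) {N T : ℕ}
    (Y : Ω → Panel N T) (J : Ω → Fin N → Fin N) : Prop where
  measurable : Measurable J
  indep : iIndepFun (fun i ω => J ω i) P
  uniform : ∀ i k, P {ω | J ω i = k} = (N : ℝ≥0∞)⁻¹
  indep_data : IndepFun Y J P

/-- Cumulative autocorrelation function `r(t) = ∑_{|s|<t} (t - |s|) ρ_s`. -/
def cumR (ρ : ℕ → ℝ) (t : ℕ) : ℝ :=
  ∑ s ∈ Finset.Ioo (-(t : ℤ)) (t : ℤ), ((t : ℝ) - (s.natAbs : ℝ)) * ρ s.natAbs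

/-- Lagged cumulative correlation function `S(t,v,d) = ∑_{s=1}^t ∑_{u=t+d}^v ρ_{u-s}`. -/
def lagS (ρ : ℕ → ℝ) (t v d : ℕ) : ℝ :=
  ∑ s ∈ Finset.Icc 1 t, ∑ u ∈ Finset.Icc (t + d) v, ρ (u - s)

/-- Shifted cumulative correlation function `R(t,v) = ∑_{s=1}^t ∑_{u=t+1}^v ρ_{u-s}`. -/
def shiftR (ρ : ℕ → ℝ) (t v : ℕ) : ℝ :=
  ∑ s ∈ Finset.Icc 1 t, ∑ u ∈ Finset.Icc (t + 1) v, ρ (u - s)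

/-- The diagonal entries `γ_{t,t}(τ)`. -/
def gammaDiag (ρ : ℕ → ℝ) (T τ t : ℕ) : ℝ :=
  if t < τ then
    cumR ρ t + (t : ℝ) ^ 2 / (τ : ℝ) ^ 2 * cumR ρ τ
      - 2 * (t : ℝ) / (τ : ℝ) * (cumR ρ t + shiftR ρ t τ)
  else if t = τ then 0
  else
    cumR ρ (t - τ) + ((t : ℝ) - τ) ^ 2 / ((T : ℝ) - τ) ^ 2 * cumR ρ (T - τ)
      - 2 * ((t : ℝ) - τ) / ((T : ℝ) - τ) * (cumR ρ (t - τ) + shiftR ρ (t - τ) (T - τ))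

/-- The entries `γ_{t,v}(τ)` for `t < v`. -/
def gammaOff (ρ : ℕ → ℝ) (T τ t v : ℕ) : ℝ :=
  if t = τ ∨ v = τ then 0
  else if v < τ then
    cumR ρ t + shiftR ρ t v + (t : ℝ) * v / (τ : ℝ) ^ 2 * cumR ρ τ
      - (v : ℝ) / τ * (cumR ρ t + shiftR ρ t τ)
      - (t : ℝ) / τ * (cumR ρ v + shiftR ρ v τ)
  else if t < τ then
    lagS ρ t v (τ + 1 - t)
      + (t : ℝ) * ((v : ℝ) - τ) / ((τ : ℝ) * ((T : ℝ) - τ)) * shiftR ρ τ T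
      - ((v : ℝ) - τ) / ((T : ℝ) - τ) * lagS ρ t T (τ + 1 - t)
      - (t : ℝ) / τ * shiftR ρ τ v
  else
    cumR ρ (t - τ) + shiftR ρ (t - τ) (v - τ)
      + ((t : ℝ) - τ) * ((v : ℝ) - τ) / ((T : ℝ) - τ) ^ 2 * cumR ρ (T - τ)
      - ((v : ℝ) - τ) / ((T : ℝ) - τ) * (cumR ρ (t - τ) + shiftR ρ (t - τ) (T - τ))
      - ((t : ℝ) - τ) / ((T : ℝ) - τ) * (cumR ρ (v - τ) + shiftR ρ (v - τ) (T - τ))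

/-- The symmetric matrix `Γ(τ)`. -/
def gammaMatrix {T : ℕ} (ρ : ℕ → ℝ) (τ : Time T) : Matrix (Time T) (Time T) ℝ :=
  Matrix.of fun t v =>
    if t = v then gammaDiag ρ T τ t
    else if t < v then gammaOff ρ T τ t v
    else gammaOff ρ T τ v t

/-- The limiting functional of `x = (x_1, …, x_T)`, with `z_t = x_T - x_t`. -/
def limitFunctional {T : ℕ} (x : Time T → ℝ) : ℝ :=
  maxOver (Finset.Icc 2 (T - 2)) fun t =>
    maxOver (Finset.Icc 1 t) (fun s => |obs x s - (s : ℝ) / (t : ℝ) * obs x t|) /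
      maxOver (Finset.Icc t (T - 1)) (fun s =>
        |(obs x T - obs x s) - ((T : ℝ) - s) / ((T : ℝ) - t) * (obs x T - obs x t)|)

/-- The law of the limiting functional at a centred Gaussian vector with covariance `Γ(τ)`. -/
def limitLaw {T : ℕ} (ρ : ℕ → ℝ) (τ : Time T) : Measure ℝ :=
  (multivariateGaussian (0 : EuclideanSpace ℝ (Time T)) (gammaMatrix ρ τ)).map
    fun x => limitFunctional (fun t => x t)

/-- `X N`, conditionally on `Y N`, converges in distribution to `ν`, in `P`-probability: for every
bounded continuous `f`, the integral of `f` against the regular conditional law of `X N` given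
`Y N` converges in probability to `∫ f dν`. -/
def CondTendstoInDistribution {Ω : Type*} [MeasurableSpace Ω] (P : Measure Ω) [IsFiniteMeasure P]
    {D : ℕ → Type*} [∀ N, MeasurableSpace (D N)] (X : ℕ → Ω → ℝ) (Y : ∀ N, Ω → D N)
    (ν : Measure ℝ) : Prop :=
  ∀ f : ℝ →ᵇ ℝ,
    TendstoInMeasure P (fun N ω => ∫ x, f x ∂(condDistrib (X N) (Y N) P (Y N ω))) atTop
      (fun _ => ∫ x, f x ∂ν)

end

end PanelChange

/-!
At the true change point `τ` the residuals do not depend on the means `μ i` and the breaks `δ i`: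
the partial sums of the residuals of row `i` are `σ` times `cumResid τ (ε i)`, a pair of bridges,
one for each regime (`rowResid_affine`, `cumResid_eq`). Expanding the product of two such bridges
shows that `Γ(τ)` is the covariance matrix of `cumResid τ (ε 0)`
(`integral_cumResid_mul_cumResid`), which makes it positive semidefinite. Moreover, the ratio
statistic of a panel is the limiting functional evaluated at the sum of the partial sums of the
rows, and that functional is invariant under positive scaling (`ratioStat_bootPanel`). So, when the
estimator hits `τ`, the bootstrap statistic is the limiting functional of the normalized centred
sum of `N` draws, with replacement, from the vectors `cumResid τ (ε i)`.

By the strong law of large numbers, for almost every realization of the errors the empirical means,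
second moments and fourth moments of these vectors converge. For a fixed sequence of vectors with
this property the bootstrap sum is asymptotically Gaussian with covariance matrix `Γ(τ)`
(`tendsto_map_bootSum`): the characteristic function of the sum is an `N`-th power, the fourth
moments control the Taylor remainder, and Lévy's theorem applies.

The limiting functional need not be continuous where one of its denominators vanishes, and nothing
excludes a degenerate `Γ(τ)`. A denominator is a maximum of absolute values of linear functionals.
If one of them has positive variance, the denominator is almost surely nonzero under the Gaussian
law. Otherwise all of them vanish almost surely at every row, so the quotient is `0` both for the
bootstrap sums and in the limit. With the quotients of the second kind dropped, the functional is
continuous on an open set of full measure, and the mapping theorem applies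
(`tendsto_integral_limitFunctional_bootSum`).

It remains to identify the integral against the conditional law with the integral over the law of
the labels at fixed data (`integral_condDistrib_of_indepFun`), and to pass from almost sure
convergence for the true change point to convergence in probability for its estimator, which differs
from the change point with probability tending to `0`.
-/

namespace PanelChange

/-! ### The central limit theorem for bootstrap sums -/

lemma norm_exp_mul_I_sub_le (x : ℝ) :
    ‖Complex.exp (x * Complex.I) - (1 + x * Complex.I - (x : ℂ) ^ 2 / 2)‖ ≤ 4 * |x| ^ 3 := by
  have hn : ‖(x : ℂ) * Complex.I‖ = |x| := by simp
  rcases le_total |x| 1 with h | h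
  · have h1 := Complex.exp_bound (x := (x : ℂ) * Complex.I) (by rw [hn]; exact h)
      (n := 3) (by norm_num)
    have h2 : ∑ m ∈ Finset.range 3, ((x : ℂ) * Complex.I) ^ m / (m.factorial : ℂ)
        = 1 + x * Complex.I - (x : ℂ) ^ 2 / 2 := by
      simp [Finset.sum_range_succ, Nat.factorial, mul_pow]
      ring
    rw [h2, hn] at h1
    refine h1.trans ?_
    have h3 : 0 ≤ |x| ^ 3 := by positivity
    norm_num [Nat.factorial]
    linarith
  · have h1 : ‖Complex.exp (x * Complex.I) - (1 + x * Complex.I - (x : ℂ) ^ 2 / 2)‖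
        ≤ 1 + (1 + |x| + |x| ^ 2 / 2) := by
      refine (norm_sub_le _ _).trans (add_le_add (Complex.norm_exp_ofReal_mul_I x).le ?_)
      refine (norm_sub_le _ _).trans (add_le_add ((norm_add_le _ _).trans ?_) ?_)
      · rw [hn]; simp
      · simp
    nlinarith [sq_nonneg (|x| - 1), mul_nonneg (abs_nonneg x) (abs_nonneg x)]

/-- The average of the first `n` terms of a sequence (`0` for `n = 0`). -/
noncomputable def avg (n : ℕ) (a : ℕ → ℝ) : ℝ := (n : ℝ)⁻¹ * ∑ k : Fin n, a k

lemma avg_add (n : ℕ) (a b : ℕ → ℝ) : avg n (fun k => a k + b k) = avg n a + avg n b := by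
  simp [avg, Finset.sum_add_distrib, mul_add]

lemma avg_const_mul (n : ℕ) (c : ℝ) (a : ℕ → ℝ) : avg n (fun k => c * a k) = c * avg n a := by
  simp [avg, ← Finset.mul_sum, mul_left_comm]

lemma avg_finsetSum {ι : Type*} (s : Finset ι) (n : ℕ) (a : ι → ℕ → ℝ) :
    avg n (fun k => ∑ t ∈ s, a t k) = ∑ t ∈ s, avg n (a t) := by
  simp only [avg]
  rw [Finset.sum_comm, Finset.mul_sum]

lemma avg_const {n : ℕ} (hn : n ≠ 0) (c : ℝ) : avg n (fun _ => c) = c := by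
  simp [avg, hn]

lemma avg_mono {n : ℕ} {a b : ℕ → ℝ} (h : ∀ k, a k ≤ b k) : avg n a ≤ avg n b :=
  mul_le_mul_of_nonneg_left (Finset.sum_le_sum fun k _ => h k) (by positivity)

lemma avg_centred {n : ℕ} (hn : n ≠ 0) (a : ℕ → ℝ) : avg n (fun k => a k - avg n a) = 0 := by
  have := avg_add n a (fun _ => -avg n a)
  rw [avg_const hn] at this
  simpa [sub_eq_add_neg] using this

lemma avg_sq_centred {n : ℕ} (hn : n ≠ 0) (a : ℕ → ℝ) :
    avg n (fun k => (a k - avg n a) ^ 2) = avg n (fun k => a k ^ 2) - avg n a ^ 2 := by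
  have h1 : (fun k => (a k - avg n a) ^ 2)
      = fun k => a k ^ 2 + ((-2 * avg n a) * a k + avg n a ^ 2) := by
    funext k; ring
  rw [h1, avg_add, avg_add, avg_const_mul, avg_const hn]
  ring

lemma avg_pow_four_centred_le {n : ℕ} (hn : n ≠ 0) (a : ℕ → ℝ) :
    avg n (fun k => (a k - avg n a) ^ 4) ≤ 8 * avg n (fun k => a k ^ 4) + 8 * avg n a ^ 4 := by
  have h1 : ∀ k, (a k - avg n a) ^ 4 ≤ 8 * a k ^ 4 + 8 * avg n a ^ 4 := fun k => by
    set m := avg n a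
    nlinarith [sq_nonneg (a k + m), sq_nonneg (a k - m), sq_nonneg ((a k) ^ 2 - m ^ 2),
      sq_nonneg ((a k + m) ^ 2), mul_nonneg (sq_nonneg (a k + m)) (sq_nonneg (a k - m))]
  refine (avg_mono h1).trans_eq ?_
  rw [avg_add, avg_const_mul, avg_const hn]

/-- The characteristic function of the normalized sum of `n` independent draws, with replacement,
from the centred values `a 0, …, a (n - 1)`, tends to that of a centred Gaussian. The fourth moments
give the Lyapunov condition. -/
lemma tendsto_bootstrap_charFun {a : ℕ → ℝ} {v C : ℝ}
    (h1 : Tendsto (fun n => avg n a) atTop (𝓝 0))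
    (h2 : Tendsto (fun n => avg n (fun k => a k ^ 2)) atTop (𝓝 v))
    (h4 : ∀ᶠ n in atTop, avg n (fun k => a k ^ 4) ≤ C) :
    Tendsto (fun n : ℕ => ((n : ℂ)⁻¹ * ∑ k : Fin n,
      Complex.exp (((√(n : ℝ))⁻¹ * (a k - avg n a) : ℝ) * Complex.I)) ^ n) atTop
      (𝓝 (Complex.exp (-(v : ℂ) / 2))) := by
  set g : ℕ → ℂ := fun n => (n : ℂ)⁻¹ * ∑ k : Fin n,
      Complex.exp (((√(n : ℝ))⁻¹ * (a k - avg n a) : ℝ) * Complex.I) - 1 with hg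
  suffices h : Tendsto (fun n : ℕ => n * g n) atTop (𝓝 (-(v : ℂ) / 2)) by
    refine (Complex.tendsto_one_add_pow_exp_of_tendsto h).congr fun n => ?_
    simp [hg]
  set s : ℕ → ℝ := fun n => avg n (fun k => (a k - avg n a) ^ 2)
  have hs : Tendsto (fun n => (-(s n : ℂ) / 2)) atTop (𝓝 (-(v : ℂ) / 2)) := by
    have : Tendsto s atTop (𝓝 v) := by
      have h := h2.sub (h1.pow 2)
      simp only [ne_eq, OfNat.ofNat_ne_zero, not_false_eq_true, zero_pow, sub_zero] at h
      refine h.congr' ?_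
      filter_upwards [eventually_ne_atTop 0] with n hn
      exact (avg_sq_centred hn a).symm
    exact ((Complex.continuous_ofReal.tendsto _).comp this).neg.div_const 2
  have hb : Tendsto (fun n : ℕ => (√(n : ℝ))⁻¹ * (4 * (1 + (8 * C + 8 * avg n a ^ 4)))) atTop
      (𝓝 0) := by
    have hr : Tendsto (fun n : ℕ => (√(n : ℝ))⁻¹) atTop (𝓝 0) :=
      tendsto_inv_atTop_zero.comp (Real.tendsto_sqrt_atTop.comp tendsto_natCast_atTop_atTop)
    have := hr.mul ((((h1.pow 4).const_mul 8).const_add (8 * C)).const_add 1 |>.const_mul 4)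
    simpa using this
  have hd : Tendsto (fun n : ℕ => n * g n - (-(s n : ℂ) / 2)) atTop (𝓝 0) := by
    refine squeeze_zero_norm' ?_ hb
    filter_upwards [eventually_ne_atTop 0, h4] with n hn hC
    have hnR : (0 : ℝ) < n := by positivity
    set b : ℕ → ℝ := fun k => a k - avg n a with hbdef
    set r : ℝ := (√(n : ℝ))⁻¹ with hr
    have hr0 : 0 ≤ r := by positivity
    have hr2 : r ^ 2 = (n : ℝ)⁻¹ := by rw [hr, inv_pow, Real.sq_sqrt hnR.le]
    have hsum0 : ∑ k : Fin n, b k = 0 := by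
      have := avg_centred hn a
      rw [avg, mul_eq_zero] at this
      exact this.resolve_left (by positivity)
    -- The linear terms add up to `0` because the values are centred.
    have e1 : (n : ℂ) * g n - (-(s n : ℂ) / 2) = ∑ k : Fin n,
        (Complex.exp ((r * b k : ℝ) * Complex.I)
          - (1 + (r * b k : ℝ) * Complex.I - ((r * b k : ℝ) : ℂ) ^ 2 / 2)) := by
      have hnC : (n : ℂ) ≠ 0 := by exact_mod_cast hn
      have q1 : ∑ k : Fin n, ((r * b k : ℝ) : ℂ) * Complex.I = 0 := by
        rw [← Finset.sum_mul, ← Complex.ofReal_sum, ← Finset.mul_sum, hsum0]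
        simp
      have q2 : ∑ k : Fin n, ((r * b k : ℝ) : ℂ) ^ 2 / 2 = (s n : ℂ) / 2 := by
        rw [← Finset.sum_div]
        congr 1
        rw [show s n = ∑ k : Fin n, (r * b k) ^ 2 by
          simp only [s, avg, mul_pow, hr2, ← Finset.mul_sum, hbdef]]
        push_cast
        rfl
      rw [Finset.sum_sub_distrib, Finset.sum_sub_distrib, Finset.sum_add_distrib, q1, q2, hg]
      simp only [Finset.sum_const, Finset.card_univ, Fintype.card_fin, nsmul_eq_mul, mul_one]
      rw [mul_sub, mul_inv_cancel_left₀ hnC]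
      ring
    rw [e1]
    calc ‖_‖ ≤ ∑ k : Fin n, 4 * |r * b k| ^ 3 :=
          norm_sum_le_of_le _ fun k _ => norm_exp_mul_I_sub_le _
      _ ≤ ∑ k : Fin n, r * (4 * (r ^ 2 * (1 + b k ^ 4))) := by
          refine Finset.sum_le_sum fun k _ => ?_
          have hcube : |b k| ^ 3 ≤ 1 + b k ^ 4 := by
            have h4' : b k ^ 4 = |b k| ^ 4 := by
              rw [show (4 : ℕ) = 2 * 2 by norm_num, pow_mul, pow_mul, sq_abs]
            rw [h4']
            have h0 := abs_nonneg (b k)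
            rcases le_total |b k| 1 with h | h
            · have := pow_le_one₀ (n := 3) h0 h
              have := pow_nonneg h0 4
              linarith
            · have := pow_le_pow_right₀ h (show 3 ≤ 4 by norm_num)
              linarith
          rw [abs_mul, abs_of_nonneg hr0, mul_pow]
          nlinarith [mul_le_mul_of_nonneg_left hcube (pow_nonneg hr0 3)]
      _ = r * (4 * (1 + avg n (fun k => b k ^ 4))) := by
          rw [← Finset.mul_sum, ← Finset.mul_sum, ← Finset.mul_sum, hr2, Finset.sum_add_distrib]
          simp [avg, mul_add, hn]
      _ ≤ r * (4 * (1 + (8 * C + 8 * avg n a ^ 4))) := by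
          have := avg_pow_four_centred_le hn a
          gcongr
          linarith
  simpa using hd.add hs

/-- The law of the labels of `N` rows drawn with replacement: independent uniform labels. -/
noncomputable def labelLaw (N : ℕ) : Measure (Fin N → Fin N) :=
  Measure.pi fun _ => uniformOn Set.univ

instance (N : ℕ) : IsProbabilityMeasure (labelLaw N) := by
  -- For `N = 0` the uniform law on `Fin 0` is the zero measure, but the empty product of measures is
  -- a Dirac mass.
  rcases N with _ | N
  · rw [labelLaw, Measure.pi_of_empty]
    infer_instance
  · have : IsProbabilityMeasure (uniformOn (Set.univ : Set (Fin (N + 1)))) :=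
      isProbabilityMeasure_uniformOn Set.finite_univ Set.univ_nonempty
    unfold labelLaw
    infer_instance

lemma integral_uniformOn_fin {N : ℕ} (f : Fin N → ℂ) :
    ∫ k, f k ∂(uniformOn (Set.univ : Set (Fin N))) = (N : ℂ)⁻¹ * ∑ k, f k := by
  have : uniformOn (Set.univ : Set (Fin N)) = (N : ℝ≥0∞)⁻¹ • Measure.count := by
    ext s _
    rw [uniformOn_univ]
    simp [div_eq_mul_inv, mul_comm]
  rw [this, integral_smul_measure, integral_count]
  simp

/-- The normalized sum of the rows of `w` with labels `j`, centred at the average of the first `N`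
rows. -/
noncomputable def bootSum {ι : Type*} (w : ℕ → ι → ℝ) (N : ℕ) (j : Fin N → Fin N) :
    EuclideanSpace ℝ ι :=
  WithLp.toLp 2 fun t => (√(N : ℝ))⁻¹ * ∑ i, (w (j i) t - avg N fun k => w k t)

/-- The law of the normalized bootstrap sum, the labels being drawn with replacement. -/
noncomputable def bootLaw {ι : Type*} [Fintype ι] (w : ℕ → ι → ℝ) (N : ℕ) :
    ProbabilityMeasure (EuclideanSpace ℝ ι) :=
  ⟨(labelLaw N).map (bootSum w N),
    Measure.isProbabilityMeasure_map (measurable_of_finite _).aemeasurable⟩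

lemma pow_four_sum_le {ι : Type*} (s : Finset ι) (f : ι → ℝ) :
    (∑ i ∈ s, f i) ^ 4 ≤ (s.card : ℝ) ^ 3 * ∑ i ∈ s, f i ^ 4 := by
  have h1 := sq_sum_le_card_mul_sum_sq (s := s) (f := f)
  have h2 := sq_sum_le_card_mul_sum_sq (s := s) (f := fun i => f i ^ 2)
  calc (∑ i ∈ s, f i) ^ 4 = ((∑ i ∈ s, f i) ^ 2) ^ 2 := by ring
    _ ≤ (s.card * ∑ i ∈ s, f i ^ 2) ^ 2 := by gcongr
    _ = (s.card : ℝ) ^ 2 * (∑ i ∈ s, f i ^ 2) ^ 2 := by ring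
    _ ≤ (s.card : ℝ) ^ 2 * (s.card * ∑ i ∈ s, (f i ^ 2) ^ 2) := by gcongr
    _ = _ := by
      simp only [← pow_mul]
      ring

lemma tendsto_avg_quadratic {ι : Type*} [Fintype ι] {w : ℕ → ι → ℝ} {Γ : Matrix ι ι ℝ}
    (h2 : ∀ t v, Tendsto (fun n => avg n fun k => w k t * w k v) atTop (𝓝 (Γ t v))) (u : ι → ℝ) :
    Tendsto (fun n => avg n fun k => (∑ t, u t * w k t) ^ 2) atTop (𝓝 (u ⬝ᵥ Γ.mulVec u)) := by
  have e : ∀ n, avg n (fun k => (∑ t, u t * w k t) ^ 2)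
      = ∑ t, ∑ v, (u t * u v) * avg n fun k => w k t * w k v := fun n => by
    rw [show (fun k => (∑ t, u t * w k t) ^ 2)
        = fun k => ∑ t, ∑ v, (u t * u v) * (w k t * w k v) by
      funext k
      rw [sq, Finset.sum_mul_sum]
      exact Finset.sum_congr rfl fun t _ => Finset.sum_congr rfl fun v _ => by ring]
    rw [avg_finsetSum]
    refine Finset.sum_congr rfl fun t _ => ?_
    rw [avg_finsetSum]
    exact Finset.sum_congr rfl fun v _ => avg_const_mul _ _ _
  simp only [e]
  have : u ⬝ᵥ Γ.mulVec u = ∑ t, ∑ v, (u t * u v) * Γ t v := by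
    simp only [dotProduct, Matrix.mulVec, Finset.mul_sum]
    exact Finset.sum_congr rfl fun t _ => Finset.sum_congr rfl fun v _ => by ring
  rw [this]
  exact tendsto_finsetSum _ fun t _ => tendsto_finsetSum _ fun v _ => (h2 t v).const_mul _

lemma charFun_map_bootSum {ι : Type*} [Fintype ι] (w : ℕ → ι → ℝ) {N : ℕ} (hN : N ≠ 0)
    (u : EuclideanSpace ℝ ι) :
    charFun ((labelLaw N).map (bootSum w N)) u = ((N : ℂ)⁻¹ * ∑ k : Fin N,
      Complex.exp (((√(N : ℝ))⁻¹ * ((∑ t, u t * w k t) - avg N fun k => ∑ t, u t * w k t) : ℝ)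
        * Complex.I)) ^ N := by
  have : NeZero N := ⟨hN⟩
  have : IsProbabilityMeasure (uniformOn (Set.univ : Set (Fin N))) :=
    isProbabilityMeasure_uniformOn Set.finite_univ Set.univ_nonempty
  rw [charFun_apply, integral_map (measurable_of_finite _).aemeasurable
    (Measurable.aestronglyMeasurable (by fun_prop))]
  have e : ∀ j : Fin N → Fin N,
      Complex.exp (((inner ℝ (bootSum w N j) u : ℝ) : ℂ) * Complex.I)
      = ∏ i, Complex.exp (((√(N : ℝ))⁻¹ * ((∑ t, u t * w (j i) t)
          - avg N fun k => ∑ t, u t * w k t) : ℝ) * Complex.I) := fun j => by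
    rw [← Complex.exp_sum, ← Finset.sum_mul, ← Complex.ofReal_sum]
    congr 3
    rw [avg_finsetSum]
    simp only [PiLp.inner_apply, bootSum, RCLike.inner_apply, conj_trivial, avg_const_mul]
    simp only [← Finset.sum_sub_distrib, ← mul_sub]
    rw [← Finset.mul_sum, Finset.sum_comm, Finset.mul_sum]
    refine Finset.sum_congr rfl fun t _ => ?_
    rw [← Finset.mul_sum]
    ring
  simp only [e]
  rw [labelLaw, integral_fintype_prod_eq_prod (𝕜 := ℂ) (fun (_ : Fin N) (k : Fin N) =>
    Complex.exp (((√(N : ℝ))⁻¹ * ((∑ t, u t * w k t)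
          - avg N fun k => ∑ t, u t * w k t) : ℝ) * Complex.I))]
  simp only [integral_uniformOn_fin, Finset.prod_const, Finset.card_univ, Fintype.card_fin]

/-- **Bootstrap central limit theorem.** If the empirical means of the rows `w 0, w 1, …` tend to
`0`, their empirical second moments to `Γ`, and their empirical fourth moments stay bounded, then
the normalized centred sum of `N` rows drawn with replacement from the first `N` rows is
asymptotically Gaussian with covariance matrix `Γ`. -/
theorem tendsto_map_bootSum {ι : Type*} [Fintype ι] [DecidableEq ι] {w : ℕ → ι → ℝ}
    {Γ : Matrix ι ι ℝ} (hΓ : Γ.PosSemidef)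
    (h1 : ∀ t, Tendsto (fun n => avg n fun k => w k t) atTop (𝓝 0))
    (h2 : ∀ t v, Tendsto (fun n => avg n fun k => w k t * w k v) atTop (𝓝 (Γ t v)))
    (h4 : ∀ t, ∃ κ, Tendsto (fun n => avg n fun k => w k t ^ 4) atTop (𝓝 κ)) :
    Tendsto (bootLaw w) atTop
      (𝓝 (⟨multivariateGaussian 0 Γ, inferInstance⟩ :
        ProbabilityMeasure (EuclideanSpace ℝ ι))) := by
  refine ProbabilityMeasure.tendsto_iff_tendsto_charFun.2 fun u => ?_
  simp only [bootLaw, ProbabilityMeasure.coe_mk, charFun_multivariateGaussian hΓ]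
  choose κ hκ using h4
  have hm : Tendsto (fun n => avg n fun k => ∑ t, u t * w k t) atTop (𝓝 0) := by
    simp only [avg_finsetSum, avg_const_mul]
    simpa using tendsto_finsetSum Finset.univ fun t _ => (h1 t).const_mul (u t)
  have hf : ∀ᶠ n in atTop, avg n (fun k => (∑ t, u t * w k t) ^ 4)
      ≤ (Fintype.card ι : ℝ) ^ 3 * ∑ t, u t ^ 4 * κ t + 1 := by
    have ht : Tendsto (fun n => (Fintype.card ι : ℝ) ^ 3 *
        ∑ t, u t ^ 4 * avg n (fun k => w k t ^ 4)) atTop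
        (𝓝 ((Fintype.card ι : ℝ) ^ 3 * ∑ t, u t ^ 4 * κ t)) :=
      (tendsto_finsetSum Finset.univ fun t _ => (hκ t).const_mul (u t ^ 4)).const_mul _
    filter_upwards [ht.eventually_le_const (lt_add_one _)] with n hn
    refine le_trans ?_ hn
    simp only [← avg_const_mul, ← avg_finsetSum]
    refine avg_mono fun k => ?_
    simpa [mul_pow] using pow_four_sum_le Finset.univ fun t => u t * w k t
  have := tendsto_bootstrap_charFun hm (tendsto_avg_quadratic h2 u) hf
  have hlim : Complex.exp (((inner ℝ u (0 : EuclideanSpace ℝ ι) : ℝ) : ℂ) * Complex.I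
      - ((WithLp.ofLp u ⬝ᵥ Γ.mulVec (WithLp.ofLp u) : ℝ) : ℂ) / 2)
      = Complex.exp (-((WithLp.ofLp u ⬝ᵥ Γ.mulVec (WithLp.ofLp u) : ℝ) : ℂ) / 2) := by
    congr 1
    simp
    ring
  rw [hlim]
  refine this.congr' ?_
  filter_upwards [eventually_ne_atTop 0] with n hn
  exact (charFun_map_bootSum w hn u).symm

/-! ### Mapping theorem and Gaussian linear functionals -/

/-- **Mapping theorem** for a map that is continuous on an open set of full limit measure. -/
theorem tendsto_integral_comp_of_continuousOn {E : Type*} [TopologicalSpace E] [MeasurableSpace E]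
    [OpensMeasurableSpace E] [HasOuterApproxClosed E] {ν : ℕ → ProbabilityMeasure E}
    {ν₀ : ProbabilityMeasure E} (hν : Tendsto ν atTop (𝓝 ν₀)) {g : E → ℝ} (hg : Measurable g)
    {O : Set E} (hO : IsOpen O) (hgO : ContinuousOn g O) (hO0 : (ν₀ : Measure E) Oᶜ = 0)
    (f : ℝ →ᵇ ℝ) :
    Tendsto (fun n => ∫ x, f (g x) ∂(ν n : Measure E)) atTop
      (𝓝 (∫ x, f (g x) ∂(ν₀ : Measure E))) := by
  have key : Tendsto (fun n => (ν n).map hg.aemeasurable) atTop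
      (𝓝 (ν₀.map hg.aemeasurable)) := by
    refine tendsto_of_forall_isClosed_limsup_le' fun F hF => ?_
    simp only [ProbabilityMeasure.toMeasure_map]
    simp only [Measure.map_apply hg hF.measurableSet]
    calc limsup (fun i => (ν i : Measure E) (g ⁻¹' F)) atTop
        ≤ limsup (fun i => (ν i : Measure E) (closure (g ⁻¹' F))) atTop :=
          limsup_le_limsup (Eventually.of_forall fun i => measure_mono subset_closure)
      _ ≤ (ν₀ : Measure E) (closure (g ⁻¹' F)) :=
          ProbabilityMeasure.limsup_measure_closed_le_of_tendsto hν isClosed_closure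
      _ ≤ (ν₀ : Measure E) (g ⁻¹' F ∪ Oᶜ) := by
          refine measure_mono fun x hx => ?_
          -- At a continuity point, `g x` is a limit of values in the closed set `F`.
          by_cases hxO : x ∈ O
          · left
            have hc : ContinuousAt g x := hgO.continuousAt (hO.mem_nhds hxO)
            have := hc.continuousWithinAt.mem_closure hx (Set.mapsTo_preimage g F)
            rwa [hF.closure_eq] at this
          · exact Or.inr hxO
      _ ≤ (ν₀ : Measure E) (g ⁻¹' F) := by
          refine (measure_union_le _ _).trans ?_
          rw [hO0, add_zero]
  have h := ProbabilityMeasure.tendsto_iff_forall_integral_tendsto.1 key f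
  simp only [ProbabilityMeasure.toMeasure_map] at h
  have e : ∀ m : Measure E, ∫ y, f y ∂(m.map g) = ∫ x, f (g x) ∂m := fun m =>
    integral_map hg.aemeasurable f.continuous.aestronglyMeasurable
  simpa only [e] using h

/-- A linear functional is almost surely zero or almost surely nonzero under a centred Gaussian
measure, according to its variance. -/
lemma ae_inner_multivariateGaussian {ι : Type*} [Fintype ι] [DecidableEq ι] {Γ : Matrix ι ι ℝ}
    (hΓ : Γ.PosSemidef) (u : EuclideanSpace ℝ ι) :
    (WithLp.ofLp u ⬝ᵥ Γ.mulVec (WithLp.ofLp u) = 0 →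
      ∀ᵐ x ∂multivariateGaussian 0 Γ, inner ℝ u x = 0) ∧
    (WithLp.ofLp u ⬝ᵥ Γ.mulVec (WithLp.ofLp u) ≠ 0 →
      ∀ᵐ x ∂multivariateGaussian 0 Γ, inner ℝ u x ≠ 0) := by
  have hm := IsGaussian.map_eq_gaussianReal (μ := multivariateGaussian 0 Γ) (innerSL ℝ u)
  have hv : Var[(innerSL ℝ u : EuclideanSpace ℝ ι → ℝ); multivariateGaussian 0 Γ]
      = WithLp.ofLp u ⬝ᵥ Γ.mulVec (WithLp.ofLp u) := by
    have := covarianceBilin_self (μ := multivariateGaussian 0 Γ) IsGaussian.memLp_two_id u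
    rw [covarianceBilin_multivariateGaussian hΓ] at this
    exact this.symm
  have hi : ∫ x, innerSL ℝ u x ∂(multivariateGaussian 0 Γ) = 0 := by
    rw [ContinuousLinearMap.integral_comp_comm _ IsGaussian.integrable_fun_id]
    simp
  have hnn : 0 ≤ WithLp.ofLp u ⬝ᵥ Γ.mulVec (WithLp.ofLp u) := by
    simpa using hΓ.dotProduct_mulVec_nonneg (WithLp.ofLp u)
  rw [hv, hi] at hm
  have ham : AEMeasurable (innerSL ℝ u : EuclideanSpace ℝ ι → ℝ) (multivariateGaussian 0 Γ) := by
    fun_prop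
  constructor
  · intro h0
    rw [h0, Real.toNNReal_zero, gaussianReal_zero_var] at hm
    have : ∀ᵐ y ∂((multivariateGaussian 0 Γ).map (innerSL ℝ u)), y = 0 := by
      rw [hm]
      exact (ae_dirac_iff (measurableSet_singleton 0)).2 rfl
    exact ae_of_ae_map ham this
  · intro h0
    have hne : (WithLp.ofLp u ⬝ᵥ Γ.mulVec (WithLp.ofLp u)).toNNReal ≠ 0 := by
      simpa using lt_of_le_of_ne hnn h0.symm
    have := nullSingletonClass_gaussianReal (μ := 0) hne
    have : ∀ᵐ y ∂((multivariateGaussian 0 Γ).map (innerSL ℝ u)), y ≠ 0 := by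
      rw [hm, ae_iff]
      simp
    exact ae_of_ae_map ham this

/-! ### Finite maxima and the limiting functional -/

lemma maxOver_congr {s : Finset ℕ} {f g : ℕ → ℝ} (h : ∀ i ∈ s, f i = g i) :
    maxOver s f = maxOver s g := by
  unfold maxOver
  split_ifs with hs
  · exact Finset.sup'_congr hs rfl h
  · rfl

lemma maxOver_const_mul {c : ℝ} (hc : 0 ≤ c) (s : Finset ℕ) (f : ℕ → ℝ) :
    maxOver s (fun i => c * f i) = c * maxOver s f := by
  unfold maxOver
  split_ifs with hs
  · exact (Finset.apply_sup'_eq_sup'_comp hs (fun x => c * x)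
      (fun x y => mul_max_of_nonneg x y hc)).symm
  · simp

lemma maxOver_eq_zero_iff {s : Finset ℕ} {f : ℕ → ℝ} (hf : ∀ i, 0 ≤ f i) :
    maxOver s f = 0 ↔ ∀ i ∈ s, f i = 0 := by
  unfold maxOver
  split_ifs with hs
  · constructor
    · intro h i hi
      exact le_antisymm (h ▸ Finset.le_sup' f hi) (hf i)
    · intro h
      obtain ⟨i, hi, he⟩ := Finset.exists_mem_eq_sup' hs f
      rw [he, h i hi]
  · simp [Finset.not_nonempty_iff_eq_empty.1 hs]

lemma continuousOn_maxOver {X : Type*} [TopologicalSpace X] {S : Set X} {s : Finset ℕ}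
    {f : X → ℕ → ℝ} (hf : ∀ i ∈ s, ContinuousOn (fun x => f x i) S) :
    ContinuousOn (fun x => maxOver s (f x)) S := by
  unfold maxOver
  split_ifs with hs
  · exact ContinuousOn.finset_sup'_apply hs hf
  · exact continuousOn_const

lemma continuous_maxOver {X : Type*} [TopologicalSpace X] {s : Finset ℕ}
    {f : X → ℕ → ℝ} (hf : ∀ i, Continuous fun x => f x i) :
    Continuous (fun x => maxOver s (f x)) := by
  rw [← continuousOn_univ]
  exact continuousOn_maxOver fun i _ => (hf i).continuousOn

lemma measurable_maxOver {X : Type*} [MeasurableSpace X] {s : Finset ℕ}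
    {f : X → ℕ → ℝ} (hf : ∀ i, Measurable fun x => f x i) :
    Measurable (fun x => maxOver s (f x)) := by
  unfold maxOver
  split_ifs with hs
  · have := Finset.measurable_sup' hs (f := fun i x => f x i) fun i _ => hf i
    convert this using 1
    ext x
    simp
  · exact measurable_const

lemma continuous_obs {T : ℕ} (t : ℕ) : Continuous fun x : Time T → ℝ => obs x t := by
  unfold obs
  split_ifs
  · fun_prop
  · exact continuous_const

/-- The linear functional whose absolute values make up the numerators of `limitFunctional`. -/
noncomputable def headDev {T : ℕ} (t s : ℕ) (x : Time T → ℝ) : ℝ :=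
  obs x s - (s : ℝ) / (t : ℝ) * obs x t

/-- The linear functional whose absolute values make up the denominators of `limitFunctional`. -/
noncomputable def tailDev {T : ℕ} (t s : ℕ) (x : Time T → ℝ) : ℝ :=
  (obs x T - obs x s) - ((T : ℝ) - s) / ((T : ℝ) - t) * (obs x T - obs x t)

/-- The denominator of `limitFunctional` at `t`. -/
noncomputable def tailMax {T : ℕ} (t : ℕ) (x : Time T → ℝ) : ℝ :=
  maxOver (Finset.Icc t (T - 1)) fun s => |tailDev t s x|

/-- The quotient of `limitFunctional` at `t`. -/
noncomputable def ratioAt {T : ℕ} (t : ℕ) (x : Time T → ℝ) : ℝ :=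
  maxOver (Finset.Icc 1 t) (fun s => |headDev t s x|) / tailMax t x

lemma limitFunctional_eq {T : ℕ} (x : Time T → ℝ) :
    limitFunctional x = maxOver (Finset.Icc 2 (T - 2)) fun t => ratioAt t x := rfl

lemma continuous_headDev {T : ℕ} (t s : ℕ) : Continuous (headDev (T := T) t s) := by
  have := continuous_obs (T := T) t
  have := continuous_obs (T := T) s
  unfold headDev
  fun_prop

lemma continuous_tailDev {T : ℕ} (t s : ℕ) : Continuous (tailDev (T := T) t s) := by
  have := continuous_obs (T := T) t
  have := continuous_obs (T := T) s
  have := continuous_obs (T := T) T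
  unfold tailDev
  fun_prop

lemma continuous_tailMax {T : ℕ} (t : ℕ) : Continuous (tailMax (T := T) t) :=
  continuous_maxOver fun s => (continuous_tailDev t s).abs

lemma measurable_ratioAt {T : ℕ} (t : ℕ) : Measurable (ratioAt (T := T) t) :=
  Measurable.div (continuous_maxOver fun s => (continuous_headDev t s).abs).measurable
    (continuous_tailMax t).measurable

lemma measurable_limitFunctional {T : ℕ} : Measurable (limitFunctional (T := T)) :=
  measurable_maxOver fun t => measurable_ratioAt t

lemma tailMax_eq_zero_iff {T : ℕ} (t : ℕ) (x : Time T → ℝ) :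
    tailMax t x = 0 ↔ ∀ s ∈ Finset.Icc t (T - 1), tailDev t s x = 0 := by
  rw [tailMax, maxOver_eq_zero_iff fun _ => abs_nonneg _]
  simp only [abs_eq_zero]

/-- Evaluation at time `t` as a linear functional. -/
noncomputable def obsL (T t : ℕ) : (Time T → ℝ) →ₗ[ℝ] ℝ where
  toFun x := obs x t
  map_add' x y := by unfold obs; split_ifs <;> simp
  map_smul' c x := by unfold obs; split_ifs <;> simp

lemma obsL_apply {T : ℕ} (t : ℕ) (x : Time T → ℝ) : obsL T t x = obs x t := rfl

/-- `tailDev` as a linear functional. -/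
noncomputable def tailDevL (T t s : ℕ) : (Time T → ℝ) →ₗ[ℝ] ℝ :=
  (obsL T T - obsL T s) - (((T : ℝ) - s) / ((T : ℝ) - t)) • (obsL T T - obsL T t)

lemma tailDevL_apply {T : ℕ} (t s : ℕ) (x : Time T → ℝ) : tailDevL T t s x = tailDev t s x := rfl

lemma limitFunctional_smul {T : ℕ} {c : ℝ} (hc : 0 < c) (x : Time T → ℝ) :
    limitFunctional (c • x) = limitFunctional x := by
  simp only [limitFunctional_eq]
  refine maxOver_congr fun t _ => ?_
  have ho : ∀ s, obs (c • x) s = c * obs x s := fun s => (obsL T s).map_smul c x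
  have h1 : ∀ s, |headDev t s (c • x)| = c * |headDev t s x| := fun s => by
    rw [← abs_of_pos hc, ← abs_mul, abs_of_pos hc]
    simp only [headDev, ho]
    congr 1
    ring
  have h2 : ∀ s, |tailDev t s (c • x)| = c * |tailDev t s x| := fun s => by
    rw [← tailDevL_apply, map_smul, smul_eq_mul, abs_mul, abs_of_pos hc, tailDevL_apply]
  simp only [ratioAt, tailMax, h1, h2, maxOver_const_mul hc.le]
  exact mul_div_mul_left _ _ hc.ne'

/-- The limiting functional with the quotients at `t ∉ G` replaced by `0`. -/
noncomputable def restrictedFunctional {T : ℕ} (G : Set ℕ) (x : Time T → ℝ) : ℝ :=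
  open scoped Classical in
  maxOver (Finset.Icc 2 (T - 2)) fun t => if t ∈ G then ratioAt t x else 0

lemma measurable_restrictedFunctional {T : ℕ} (G : Set ℕ) :
    Measurable (restrictedFunctional (T := T) G) := by
  classical
  refine measurable_maxOver fun t => ?_
  by_cases h : t ∈ G
  · simp only [h, if_true]
    exact measurable_ratioAt t
  · simp only [h, if_false]
    exact measurable_const

lemma restrictedFunctional_eq_limitFunctional {T : ℕ} {G : Set ℕ} {x : Time T → ℝ}
    (h : ∀ t ∈ Finset.Icc 2 (T - 2), t ∉ G → tailMax t x = 0) :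
    restrictedFunctional G x = limitFunctional x := by
  classical
  rw [limitFunctional_eq]
  refine maxOver_congr fun t ht => ?_
  split_ifs with hG
  · rfl
  · rw [ratioAt, h t ht hG, div_zero]

/-- The set on which no denominator with index in `G` vanishes. -/
def regularSet (T : ℕ) (G : Set ℕ) : Set (Time T → ℝ) :=
  {x | ∀ t ∈ Finset.Icc 2 (T - 2), t ∈ G → tailMax t x ≠ 0}

lemma isOpen_regularSet (T : ℕ) (G : Set ℕ) : IsOpen (regularSet T G) := by
  have : regularSet T G = ⋂ t ∈ Finset.Icc 2 (T - 2), {x | t ∈ G → tailMax t x ≠ 0} := by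
    ext x
    simp only [regularSet, Set.mem_ofPred_eq, Set.mem_iInter]
  rw [this]
  refine isOpen_biInter_finset fun t _ => ?_
  by_cases hG : t ∈ G
  · simp only [hG, true_implies]
    exact isOpen_ne_fun (continuous_tailMax t) continuous_const
  · simp [hG]

lemma continuousOn_restrictedFunctional (T : ℕ) (G : Set ℕ) :
    ContinuousOn (restrictedFunctional (T := T) G) (regularSet T G) := by
  classical
  refine continuousOn_maxOver fun t ht => ?_
  by_cases hG : t ∈ G
  · simp only [hG, if_true]
    exact ContinuousOn.div
      (continuous_maxOver fun s => (continuous_headDev t s).abs).continuousOn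
      (continuous_tailMax t).continuousOn fun x hx => hx t ht hG
  · simp only [hG, if_false]
    exact continuousOn_const

/-! ### Limit of the functional of the bootstrap sums -/

/-- The coefficient vector of `tailDev`. -/
noncomputable def tailCoeff (T t s : ℕ) : EuclideanSpace ℝ (Time T) :=
  WithLp.toLp 2 fun q => tailDevL T t s fun r => if q = r then 1 else 0

lemma tailDev_eq_sum {T : ℕ} (t s : ℕ) (x : Time T → ℝ) :
    tailDev t s x = ∑ q, tailCoeff T t s q * x q := by
  rw [← tailDevL_apply, LinearMap.pi_apply_eq_sum_univ]
  simp [tailCoeff, mul_comm]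

lemma tailDev_eq_inner {T : ℕ} (t s : ℕ) (x : EuclideanSpace ℝ (Time T)) :
    tailDev t s (fun q => x q) = inner ℝ (tailCoeff T t s) x := by
  rw [tailDev_eq_sum, PiLp.inner_apply]
  simp [mul_comm]

/-- The variance of `tailDev` at a centred vector with covariance matrix `Γ`. -/
noncomputable def tailVar {T : ℕ} (Γ : Matrix (Time T) (Time T) ℝ) (t s : ℕ) : ℝ :=
  WithLp.ofLp (tailCoeff T t s) ⬝ᵥ Γ.mulVec (WithLp.ofLp (tailCoeff T t s))

/-- The bootstrap limit theorem for a fixed sequence of rows. No nondegeneracy of `Γ` is needed: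
a denominator either is almost surely nonzero in the limit, or it vanishes identically both for the
bootstrap sums and in the limit. -/
theorem tendsto_integral_limitFunctional_bootSum {T : ℕ} {w : ℕ → Time T → ℝ}
    {Γ : Matrix (Time T) (Time T) ℝ} (hΓ : Γ.PosSemidef)
    (h1 : ∀ t, Tendsto (fun n => avg n fun k => w k t) atTop (𝓝 0))
    (h2 : ∀ t v, Tendsto (fun n => avg n fun k => w k t * w k v) atTop (𝓝 (Γ t v)))
    (h4 : ∀ t, ∃ κ, Tendsto (fun n => avg n fun k => w k t ^ 4) atTop (𝓝 κ))
    (h0 : ∀ t s, tailVar Γ t s = 0 → ∀ k, tailDev t s (w k) = 0) (f : ℝ →ᵇ ℝ) :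
    Tendsto (fun N => ∫ j, f (limitFunctional fun t => bootSum w N j t) ∂labelLaw N) atTop
      (𝓝 (∫ x : EuclideanSpace ℝ (Time T), f (limitFunctional fun t => x t)
        ∂multivariateGaussian 0 Γ)) := by
  -- The indices whose denominator is almost surely nonzero in the limit.
  set G : Set ℕ := {t | ∃ s ∈ Finset.Icc t (T - 1), tailVar Γ t s ≠ 0} with hG
  have hcont : Continuous fun (x : EuclideanSpace ℝ (Time T)) (t : Time T) => x t := by fun_prop
  have hreg : ∀ᵐ x : EuclideanSpace ℝ (Time T) ∂multivariateGaussian 0 Γ,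
      (fun t => x t) ∈ regularSet T G := by
    have : ∀ t : ℕ, ∀ᵐ x : EuclideanSpace ℝ (Time T) ∂multivariateGaussian 0 Γ,
        t ∈ G → tailMax t (fun q => x q) ≠ 0 := fun t => by
      by_cases ht : t ∈ G
      · obtain ⟨s, hs, hv⟩ := ht
        filter_upwards [(ae_inner_multivariateGaussian hΓ (tailCoeff T t s)).2 hv] with x hx _ h
        rw [tailMax_eq_zero_iff] at h
        exact hx (tailDev_eq_inner t s x ▸ h s hs)
      · exact Eventually.of_forall fun x h => absurd h ht
    filter_upwards [ae_all_iff.2 this] with x hx t _ using hx t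
  have hdeg : ∀ᵐ x : EuclideanSpace ℝ (Time T) ∂multivariateGaussian 0 Γ,
      restrictedFunctional G (fun t => x t) = limitFunctional fun t => x t := by
    have : ∀ t s : ℕ, ∀ᵐ x : EuclideanSpace ℝ (Time T) ∂multivariateGaussian 0 Γ,
        tailVar Γ t s = 0 → tailDev t s (fun q => x q) = 0 := fun t s => by
      by_cases hv : tailVar Γ t s = 0
      · filter_upwards [(ae_inner_multivariateGaussian hΓ (tailCoeff T t s)).1 hv] with x hx _
        rw [tailDev_eq_inner, hx]
      · exact Eventually.of_forall fun x h => absurd h hv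
    filter_upwards [ae_all_iff.2 fun t => ae_all_iff.2 (this t)] with x hx
    refine restrictedFunctional_eq_limitFunctional fun t _ ht => ?_
    rw [tailMax_eq_zero_iff]
    intro s hs
    refine hx t s ?_
    by_contra hv
    exact ht ⟨s, hs, hv⟩
  have hboot : ∀ N j, restrictedFunctional G (fun t => bootSum w N j t)
      = limitFunctional fun t => bootSum w N j t := fun N j => by
    refine restrictedFunctional_eq_limitFunctional fun t _ ht => ?_
    rw [tailMax_eq_zero_iff]
    intro s hs
    have hv : tailVar Γ t s = 0 := by
      by_contra hv
      exact ht ⟨s, hs, hv⟩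
    have e : (fun q => bootSum w N j q) = (√(N : ℝ))⁻¹ • ∑ i : Fin N,
        (w (j i) - (N : ℝ)⁻¹ • ∑ k : Fin N, w k) := by
      funext q
      simp only [bootSum, avg, Finset.sum_apply, Pi.smul_apply, Pi.sub_apply, smul_eq_mul]
    rw [e, ← tailDevL_apply]
    simp only [map_smul, map_sum, map_sub, tailDevL_apply, h0 t s hv, Finset.sum_const_zero,
      smul_zero, sub_zero]
  have hmain := tendsto_integral_comp_of_continuousOn (tendsto_map_bootSum hΓ h1 h2 h4)
    ((measurable_restrictedFunctional G).comp hcont.measurable)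
    ((isOpen_regularSet T G).preimage hcont)
    ((continuousOn_restrictedFunctional T G).comp hcont.continuousOn (Set.mapsTo_preimage _ _))
    (by rw [← Set.preimage_compl]; exact hreg) f
  have elim : ∫ x : EuclideanSpace ℝ (Time T), f (limitFunctional fun t => x t)
      ∂multivariateGaussian 0 Γ = ∫ x : EuclideanSpace ℝ (Time T),
        f (restrictedFunctional G fun t => x t) ∂multivariateGaussian 0 Γ :=
    integral_congr_ae (hdeg.mono fun x hx => by simp only [hx])
  rw [elim]
  refine hmain.congr fun N => ?_
  simp only [bootLaw, ProbabilityMeasure.coe_mk]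
  rw [integral_map (measurable_of_finite _).aemeasurable]
  · simp only [Function.comp_apply, hboot]
  · exact (f.continuous.measurable.comp
      ((measurable_restrictedFunctional G).comp hcont.measurable)).aestronglyMeasurable

/-! ### Partial sums of residuals and the ratio statistic -/

lemma obs_of_mem {T : ℕ} (x : Time T → ℝ) {t : ℕ} (h : t ∈ Finset.Icc 1 T) :
    obs x t = x ⟨t, h⟩ := dif_pos h

/-- The partial sums of a row, as a linear map. -/
noncomputable def cumSumL (T : ℕ) : (Time T → ℝ) →ₗ[ℝ] (Time T → ℝ) :=
  LinearMap.pi fun t => ∑ q ∈ Finset.Icc 1 (t : ℕ), obsL T q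

lemma cumSumL_apply {T : ℕ} (x : Time T → ℝ) (t : Time T) :
    cumSumL T x t = ∑ q ∈ Finset.Icc 1 (t : ℕ), obs x q := by
  simp [cumSumL, obsL_apply]

lemma obs_cumSumL {T : ℕ} (x : Time T → ℝ) {t : ℕ} (h : t ∈ Finset.Icc 1 T) :
    obs (cumSumL T x) t = ∑ q ∈ Finset.Icc 1 t, obs x q := by
  rw [obs_of_mem _ h, cumSumL_apply]

lemma sum_Icc_succ_eq_sub (f : ℕ → ℝ) {a b : ℕ} (h : a ≤ b) :
    ∑ q ∈ Finset.Icc (a + 1) b, f q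
      = ∑ q ∈ Finset.Icc 1 b, f q - ∑ q ∈ Finset.Icc 1 a, f q := by
  have h1 : ∀ n, Finset.Icc 1 n = Finset.Ioc 0 n := fun n => rfl
  have h2 : Finset.Icc (a + 1) b = Finset.Ioc a b := by
    ext q
    simp only [Finset.mem_Icc, Finset.mem_Ioc]
    omega
  rw [h1, h1, h2, eq_sub_iff_add_eq, add_comm]
  exact Finset.sum_Ioc_consecutive f (Nat.zero_le a) h

lemma sum_sub_headMean {T : ℕ} (x : Time T → ℝ) {t s : ℕ} (ht : t ∈ Finset.Icc 1 T)
    (hs : s ∈ Finset.Icc 1 T) :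
    ∑ q ∈ Finset.Icc 1 s, (obs x q - headMean x t) = headDev t s (cumSumL T x) := by
  rw [headDev, obs_cumSumL x ht, obs_cumSumL x hs, Finset.sum_sub_distrib, headMean]
  simp
  ring

lemma sum_sub_tailMean {T : ℕ} (x : Time T → ℝ) {t s : ℕ} (ht : t ∈ Finset.Icc 1 T)
    (hs : s ∈ Finset.Icc 1 T) :
    ∑ q ∈ Finset.Icc (s + 1) T, (obs x q - tailMean x t) = tailDev t s (cumSumL T x) := by
  have ht' := Finset.mem_Icc.1 ht
  have hs' := Finset.mem_Icc.1 hs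
  have hT : T ∈ Finset.Icc 1 T := Finset.mem_Icc.2 ⟨by omega, le_rfl⟩
  rw [tailDev, obs_cumSumL x ht, obs_cumSumL x hs, obs_cumSumL x hT, Finset.sum_sub_distrib,
    tailMean, sum_Icc_succ_eq_sub _ hs'.2, sum_Icc_succ_eq_sub _ ht'.2]
  have : ((T + 1 - (s + 1) : ℕ) : ℝ) = (T : ℝ) - s := by
    rw [Nat.add_sub_add_right, Nat.cast_sub hs'.2]
  simp only [Finset.sum_const, Nat.card_Icc, nsmul_eq_mul, this]
  ring

lemma ratioStat_eq_limitFunctional {N T : ℕ} (y : Panel N T) :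
    ratioStat y = limitFunctional (∑ i, cumSumL T (y i)) := by
  have hh : ∀ t s, headDev t s (∑ i, cumSumL T (y i)) = ∑ i, headDev t s (cumSumL T (y i)) :=
    fun t s => map_sum (obsL T s - ((s : ℝ) / (t : ℝ)) • obsL T t) _ _
  have ht : ∀ t s, tailDev t s (∑ i, cumSumL T (y i)) = ∑ i, tailDev t s (cumSumL T (y i)) :=
    fun t s => map_sum (tailDevL T t s) _ _
  rw [limitFunctional_eq, ratioStat]
  refine maxOver_congr fun t htm => ?_
  have htm' := Finset.mem_Icc.1 htm
  have hmem : t ∈ Finset.Icc 1 T := Finset.mem_Icc.2 (by omega)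
  rw [ratioAt, tailMax]
  congr 1
  · refine maxOver_congr fun s hs => ?_
    have hs' := Finset.mem_Icc.1 hs
    simp only [sum_sub_headMean _ hmem (Finset.mem_Icc.2 (show 1 ≤ s ∧ s ≤ T by omega)), hh]
  · refine maxOver_congr fun s hs => ?_
    have hs' := Finset.mem_Icc.1 hs
    simp only [sum_sub_tailMean _ hmem (Finset.mem_Icc.2 (show 1 ≤ s ∧ s ≤ T by omega)), ht]

/-- The residuals of a single row for the change point `k`. -/
noncomputable def rowResid {T : ℕ} (k : Time T) (x : Time T → ℝ) : Time T → ℝ := fun t =>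
  if t ≤ k then x t - headMean x k else x t - tailMean x k

lemma headMean_affine {T : ℕ} (x : Time T → ℝ) (m d σ : ℝ) (τ : Time T) :
    headMean (fun t => m + (if τ < t then d else 0) + σ * x t) τ = m + σ * headMean x τ := by
  have h1 : (1 : ℕ) ≤ τ := (Finset.mem_Icc.1 τ.2).1
  have h2 : (τ : ℕ) ≤ T := (Finset.mem_Icc.1 τ.2).2
  have h0 : ((τ : ℕ) : ℝ) ≠ 0 := by positivity
  have e : ∀ q ∈ Finset.Icc 1 (τ : ℕ),
      obs (fun t => m + (if τ < t then d else 0) + σ * x t) q = m + σ * obs x q := fun q hq => by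
    have hq' := Finset.mem_Icc.1 hq
    have hm : q ∈ Finset.Icc 1 T := Finset.mem_Icc.2 ⟨hq'.1, hq'.2.trans h2⟩
    rw [obs_of_mem _ hm, obs_of_mem _ hm, if_neg (by simpa [← Subtype.coe_lt_coe] using hq'.2),
      add_zero]
  rw [headMean, headMean, Finset.sum_congr rfl e, Finset.sum_add_distrib, ← Finset.mul_sum]
  simp only [Finset.sum_const, Nat.card_Icc, nsmul_eq_mul, Nat.add_sub_cancel]
  field_simp

lemma tailMean_affine {T : ℕ} (x : Time T → ℝ) (m d σ : ℝ) (τ : Time T) (hτ : (τ : ℕ) < T) :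
    tailMean (fun t => m + (if τ < t then d else 0) + σ * x t) τ
      = m + d + σ * tailMean x τ := by
  have h0 : (T : ℝ) - (τ : ℕ) ≠ 0 := sub_ne_zero.2 (by exact_mod_cast hτ.ne')
  have e : ∀ q ∈ Finset.Icc ((τ : ℕ) + 1) T,
      obs (fun t => m + (if τ < t then d else 0) + σ * x t) q = m + d + σ * obs x q :=
    fun q hq => by
      have hq' := Finset.mem_Icc.1 hq
      have hm : q ∈ Finset.Icc 1 T := Finset.mem_Icc.2 ⟨by omega, hq'.2⟩
      rw [obs_of_mem _ hm, obs_of_mem _ hm,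
        if_pos (show τ < ⟨q, hm⟩ by rw [← Subtype.coe_lt_coe]; exact hq'.1)]
  rw [tailMean, tailMean, Finset.sum_congr rfl e, Finset.sum_add_distrib, ← Finset.mul_sum]
  simp only [Finset.sum_const, Nat.card_Icc, nsmul_eq_mul, Nat.add_sub_add_right,
    Nat.cast_sub hτ.le]
  field_simp

/-- At the true change point, the residuals do not depend on the means and the breaks. -/
lemma rowResid_affine {T : ℕ} (x : Time T → ℝ) (m d σ : ℝ) (τ : Time T) :
    rowResid τ (fun t => m + (if τ < t then d else 0) + σ * x t) = σ • rowResid τ x := by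
  funext t
  simp only [rowResid, Pi.smul_apply, smul_eq_mul]
  split_ifs with h1 h2 h2
  · exact absurd h2 (not_lt.2 h1)
  · rw [headMean_affine]
    ring
  · have : (τ : ℕ) < T := lt_of_lt_of_le (Subtype.coe_lt_coe.2 h2) (Finset.mem_Icc.1 t.2).2
    rw [tailMean_affine _ _ _ _ _ this]
    ring
  · exact absurd (not_le.1 h1) h2

/-- The partial sums of the residuals of a row for the change point `k`. -/
noncomputable def cumResid {T : ℕ} (k : Time T) (x : Time T → ℝ) : Time T → ℝ :=
  cumSumL T (rowResid k x)

/-- The statistic of the bootstrap panel built with the true change point, as the limiting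
functional of the normalized bootstrap sum of the partial sums of residuals. -/
lemma ratioStat_bootPanel {Ω : Type*} {T : ℕ} (μ δ : ℕ → ℝ) {σ : ℝ} (hσ : 0 < σ) (τ : Time T)
    (ε : ℕ → Ω → Time T → ℝ) {N : ℕ} (hN : N ≠ 0) (ω : Ω) (j : Fin N → Fin N) :
    ratioStat (bootPanel (residual τ (panelData μ δ σ τ ε N ω)) j)
      = limitFunctional fun t => bootSum (fun k => cumResid τ (ε k ω)) N j t := by
  have hN' : (0 : ℝ) < N := by positivity
  have hres : ∀ i : Fin N, residual τ (panelData μ δ σ τ ε N ω) i = σ • rowResid τ (ε i ω) :=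
    fun i => rowResid_affine _ _ _ _ _
  have hrow : ∀ i, bootPanel (residual τ (panelData μ δ σ τ ε N ω)) j i
      = σ • (rowResid τ (ε (j i) ω) - (N : ℝ)⁻¹ • ∑ l : Fin N, rowResid τ (ε l ω)) := fun i => by
    funext t
    simp only [bootPanel, hres, Pi.smul_apply, Pi.sub_apply, Finset.sum_apply, smul_eq_mul,
      ← Finset.mul_sum]
    ring
  rw [ratioStat_eq_limitFunctional,
    ← limitFunctional_smul (show 0 < (σ * √(N : ℝ))⁻¹ by positivity)]
  congr 1
  funext t
  simp only [hrow, map_smul, map_sub, map_sum, bootSum, cumResid, avg, Pi.smul_apply,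
    Finset.sum_apply, Pi.sub_apply, smul_eq_mul, ← Finset.mul_sum]
  rw [mul_inv]
  field_simp
  simp only [mul_comm]

/-! ### Measurability -/

lemma measurable_obs {T : ℕ} (t : ℕ) : Measurable fun x : Time T → ℝ => obs x t :=
  (continuous_obs t).measurable

lemma measurable_rowResid {T : ℕ} (k : Time T) : Measurable (rowResid k) := by
  have hh : Measurable fun x : Time T → ℝ => headMean x k := by
    unfold headMean
    exact (Finset.measurable_sum _ fun s _ => measurable_obs s).const_mul _
  have ht : Measurable fun x : Time T → ℝ => tailMean x k := by
    unfold tailMean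
    exact (Finset.measurable_sum _ fun s _ => measurable_obs s).const_mul _
  refine measurable_pi_lambda _ fun t => ?_
  unfold rowResid
  split_ifs
  · exact (measurable_pi_apply t).sub hh
  · exact (measurable_pi_apply t).sub ht

lemma measurable_cumSumL (T : ℕ) : Measurable (cumSumL T) :=
  (cumSumL T).continuous_of_finiteDimensional.measurable

lemma measurable_cumResid {T : ℕ} (k : Time T) : Measurable (cumResid k) :=
  (measurable_cumSumL T).comp (measurable_rowResid k)

lemma measurable_ratioStat {N T : ℕ} : Measurable (ratioStat (N := N) (T := T)) := by
  rw [show ratioStat (N := N) (T := T) = fun y => limitFunctional (∑ i, cumSumL T (y i)) from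
    funext ratioStat_eq_limitFunctional]
  refine measurable_limitFunctional.comp (Finset.measurable_sum _ fun i _ => ?_)
  exact (measurable_cumSumL T).comp (measurable_pi_apply i)

lemma measurable_ratioStat_bootPanel {N T : ℕ} (k : Time T) (j : Fin N → Fin N) :
    Measurable fun y : Panel N T => ratioStat (bootPanel (residual k y) j) := by
  have hres : ∀ i, Measurable fun y : Panel N T => residual k y i := fun i =>
    (measurable_rowResid k).comp (measurable_pi_apply i)
  refine measurable_ratioStat.comp (measurable_pi_lambda _ fun i => measurable_pi_lambda _ fun t =>
    ?_)
  unfold bootPanel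
  exact ((measurable_pi_apply t).comp (hres (j i))).sub
    ((Finset.measurable_sum _ fun l _ => (measurable_pi_apply t).comp (hres l)).const_mul _)

lemma measurable_ratioStat_bootPanel_prod {N T : ℕ} (j : Fin N → Fin N) :
    Measurable fun p : Time T × Panel N T => ratioStat (bootPanel (residual p.1 p.2) j) := by
  apply measurable_from_prod_countable_right
  intro k
  exact measurable_ratioStat_bootPanel k j

lemma measurable_bootStat_left {N T : ℕ} {tauHat : Panel N T → Time T} (h : Measurable tauHat)
    (j : Fin N → Fin N) : Measurable fun y : Panel N T => bootStat tauHat y j := by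
  have := (measurable_ratioStat_bootPanel_prod j).comp (h.prodMk measurable_id)
  exact this

lemma measurable_bootStat {N T : ℕ} {tauHat : Panel N T → Time T} (h : Measurable tauHat) :
    Measurable fun p : Panel N T × (Fin N → Fin N) => bootStat tauHat p.1 p.2 := by
  apply measurable_from_prod_countable_left
  intro j
  exact measurable_bootStat_left h j

lemma measurable_panelData {Ω : Type*} [MeasurableSpace Ω] {T : ℕ} (μ δ : ℕ → ℝ) (σ : ℝ)
    (τ : Time T) {ε : ℕ → Ω → Time T → ℝ} (hε : ∀ i, Measurable (ε i)) (N : ℕ) :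
    Measurable (panelData μ δ σ τ ε N) := by
  refine measurable_pi_lambda _ fun i => measurable_pi_lambda _ fun t => ?_
  unfold panelData
  exact ((((measurable_pi_apply t).comp (hε i))).const_mul σ).const_add _

/-! ### The conditional law of the bootstrap statistic -/

lemma map_labels_eq_labelLaw {Ω : Type*} [MeasurableSpace Ω] {P : Measure Ω}
    [IsProbabilityMeasure P] {N T : ℕ} {Y : Ω → Panel N T} {J : Ω → Fin N → Fin N}
    (h : IsResampling P Y J) : P.map J = labelLaw N := by
  have hJ : ∀ i, Measurable fun ω => J ω i := fun i => (measurable_pi_apply i).comp h.measurable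
  have h1 := (iIndepFun_iff_map_fun_eq_pi_map fun i => (hJ i).aemeasurable).1 h.indep
  change P.map J = _ at h1
  rw [h1, labelLaw]
  congr 1
  funext i
  refine Measure.ext_of_singleton fun k => ?_
  rw [Measure.map_apply (hJ i) (measurableSet_singleton k), uniformOn_univ]
  refine (h.uniform i k).trans ?_
  simp

/-- If `J` is independent of `Y`, then conditionally on `Y` the statistic `φ (Y, J)` is integrated
over the law of `J` with `Y` fixed. -/
lemma integral_condDistrib_of_indepFun {Ω α β : Type*} [MeasurableSpace Ω] {P : Measure Ω}
    [IsProbabilityMeasure P] [MeasurableSpace α] [MeasurableSpace β] {Y : Ω → α} {J : Ω → β}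
    (hY : Measurable Y) (hJ : Measurable J) (hind : IndepFun Y J P) {φ : α × β → ℝ}
    (hφ : Measurable φ) (f : ℝ →ᵇ ℝ) :
    ∀ᵐ ω ∂P, ∫ x, f x ∂(condDistrib (fun ω => φ (Y ω, J ω)) Y P (Y ω))
      = ∫ j, f (φ (Y ω, j)) ∂(P.map J) := by
  have : IsProbabilityMeasure (P.map J) := Measure.isProbabilityMeasure_map hJ.aemeasurable
  set κ : Kernel α ℝ := (Kernel.id ×ₖ Kernel.const α (P.map J)).map φ with hκ
  have hmap : P.map (fun ω => (Y ω, φ (Y ω, J ω))) = P.map Y ⊗ₘ κ := by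
    have h1 : P.map (fun ω => (Y ω, φ (Y ω, J ω)))
        = ((P.map Y).prod (P.map J)).map fun p => (p.1, φ p) := by
      rw [← (indepFun_iff_map_prod_eq_prod_map_map hY.aemeasurable hJ.aemeasurable).1 hind,
        Measure.map_map (by fun_prop) (by fun_prop)]
      rfl
    rw [h1]
    ext s hs
    rw [Measure.map_apply (by fun_prop) hs,
      Measure.prod_apply ((show Measurable fun p : α × β => (p.1, φ p) by fun_prop) hs),
      Measure.compProd_apply hs]
    refine lintegral_congr fun y => ?_
    rw [hκ, Kernel.map_apply' _ hφ _ (measurable_prodMk_left hs), Kernel.prod_apply,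
      Kernel.id_apply, Kernel.const_apply, Measure.dirac_prod,
      Measure.map_apply (by fun_prop) (hφ (measurable_prodMk_left hs))]
    rfl
  have hae := condDistrib_ae_eq_of_measure_eq_compProd Y
    (hφ.comp (hY.prodMk hJ)).aemeasurable hmap
  filter_upwards [ae_of_ae_map hY.aemeasurable hae] with ω hω
  have hω' : condDistrib (fun ω => φ (Y ω, J ω)) Y P (Y ω) = κ (Y ω) := hω
  rw [hω', hκ, Kernel.map_apply _ hφ, Kernel.prod_apply, Kernel.id_apply, Kernel.const_apply,
    Measure.dirac_prod, Measure.map_map hφ (by fun_prop),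
    integral_map (by fun_prop) f.continuous.aestronglyMeasurable]
  rfl

/-! ### The matrix `Γ` as a covariance matrix -/

/-- The covariance of the sums over the times in `A` and in `B` of a stationary sequence with
autocorrelation function `ρ`. -/
def corrSum (ρ : ℕ → ℝ) (A B : Finset ℕ) : ℝ :=
  ∑ q ∈ A, ∑ u ∈ B, ρ ((q : ℤ) - u).natAbs

lemma corrSum_comm (ρ : ℕ → ℝ) (A B : Finset ℕ) : corrSum ρ A B = corrSum ρ B A := by
  rw [corrSum, corrSum, Finset.sum_comm]
  exact Finset.sum_congr rfl fun q _ => Finset.sum_congr rfl fun u _ => by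
    rw [← Int.natAbs_neg, neg_sub]

lemma sum_Icc_add_left (f : ℕ → ℝ) (a t : ℕ) :
    ∑ q ∈ Finset.Icc (a + 1) (a + t), f q = ∑ q ∈ Finset.Icc 1 t, f (a + q) := by
  rw [← Finset.map_add_left_Icc, Finset.sum_map]
  rfl

lemma corrSum_shift (ρ : ℕ → ℝ) (a t v : ℕ) :
    corrSum ρ (Finset.Icc (a + 1) (a + t)) (Finset.Icc (a + 1) (a + v))
      = corrSum ρ (Finset.Icc 1 t) (Finset.Icc 1 v) := by
  simp only [corrSum, sum_Icc_add_left]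
  refine Finset.sum_congr rfl fun q _ => Finset.sum_congr rfl fun u _ => ?_
  congr 2
  push_cast
  ring

lemma sum_Ioo_natAbs (f : ℕ → ℝ) (t : ℕ) :
    ∑ s ∈ Finset.Ioo (-((t + 1 : ℕ) : ℤ)) ((t + 1 : ℕ) : ℤ), f s.natAbs
      = f 0 + 2 * ∑ s ∈ Finset.Icc 1 t, f s := by
  induction t with
  | zero =>
    have : Finset.Ioo (-((0 + 1 : ℕ) : ℤ)) ((0 + 1 : ℕ) : ℤ) = {0} := by
      ext s
      simp only [Finset.mem_Ioo, Finset.mem_singleton]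
      omega
    rw [this]
    simp
  | succ t ih =>
    have h1 : Finset.Ioo (-((t + 1 + 1 : ℕ) : ℤ)) ((t + 1 + 1 : ℕ) : ℤ)
        = insert ((t + 1 : ℕ) : ℤ) (insert (-((t + 1 : ℕ) : ℤ))
          (Finset.Ioo (-((t + 1 : ℕ) : ℤ)) ((t + 1 : ℕ) : ℤ))) := by
      ext s
      simp only [Finset.mem_Ioo, Finset.mem_insert]
      omega
    rw [h1, Finset.sum_insert (by simp only [Finset.mem_Ioo, Finset.mem_insert]; omega),
      Finset.sum_insert (by simp only [Finset.mem_Ioo]; omega), ih,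
      Finset.sum_Icc_succ_top (by omega), Int.natAbs_neg, Int.natAbs_natCast]
    ring

lemma cumR_succ (ρ : ℕ → ℝ) (t : ℕ) :
    cumR ρ (t + 1) = cumR ρ t + (ρ 0 + 2 * ∑ s ∈ Finset.Icc 1 t, ρ s) := by
  rw [← sum_Ioo_natAbs]
  -- The two terms with `|s| = t` have weight `0` in `cumR ρ t`.
  have h1 : cumR ρ t = ∑ s ∈ Finset.Ioo (-((t + 1 : ℕ) : ℤ)) ((t + 1 : ℕ) : ℤ),
      ((t : ℝ) - (s.natAbs : ℝ)) * ρ s.natAbs := by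
    rw [cumR]
    refine Finset.sum_subset (fun s => ?_) fun s hs hs' => ?_
    · simp only [Finset.mem_Ioo]
      omega
    · simp only [Finset.mem_Ioo] at hs hs'
      have : s.natAbs = t := by omega
      rw [this]
      ring
  rw [h1, cumR, ← Finset.sum_add_distrib]
  exact Finset.sum_congr rfl fun s _ => by push_cast; ring

lemma sum_Icc_reflect (f : ℕ → ℝ) (t : ℕ) :
    ∑ q ∈ Finset.Icc 1 t, f (t + 1 - q) = ∑ s ∈ Finset.Icc 1 t, f s := by
  refine Finset.sum_nbij' (fun q => t + 1 - q) (fun q => t + 1 - q) ?_ ?_ ?_ ?_ fun _ _ => rfl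
  all_goals
    simp only [Finset.mem_Icc]
    omega

lemma corrSum_self (ρ : ℕ → ℝ) (t : ℕ) :
    corrSum ρ (Finset.Icc 1 t) (Finset.Icc 1 t) = cumR ρ t := by
  induction t with
  | zero => simp [corrSum, cumR]
  | succ t ih =>
    have h1 : ∑ q ∈ Finset.Icc 1 t, ρ ((q : ℤ) - ((t + 1 : ℕ) : ℤ)).natAbs
        = ∑ s ∈ Finset.Icc 1 t, ρ s := by
      rw [← sum_Icc_reflect]
      refine Finset.sum_congr rfl fun q hq => ?_
      have := Finset.mem_Icc.1 hq
      congr 1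
      omega
    have h2 : ∑ q ∈ Finset.Icc 1 t, ρ (((t + 1 : ℕ) : ℤ) - (q : ℤ)).natAbs
        = ∑ s ∈ Finset.Icc 1 t, ρ s := by
      rw [← h1]
      exact Finset.sum_congr rfl fun q _ => by rw [← Int.natAbs_neg, neg_sub]
    rw [cumR_succ, ← ih]
    simp only [corrSum, Finset.sum_Icc_succ_top (Nat.succ_pos t), Finset.sum_add_distrib, h1, h2,
      sub_self, Int.natAbs_zero]
    ring

lemma corrSum_Icc_succ (ρ : ℕ → ℝ) {t a v : ℕ} (h : t ≤ a) :
    corrSum ρ (Finset.Icc 1 t) (Finset.Icc (a + 1) v)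
      = ∑ s ∈ Finset.Icc 1 t, ∑ u ∈ Finset.Icc (a + 1) v, ρ (u - s) := by
  refine Finset.sum_congr rfl fun q hq => Finset.sum_congr rfl fun u hu => ?_
  have := Finset.mem_Icc.1 hq
  have := Finset.mem_Icc.1 hu
  congr 1
  omega

lemma corrSum_eq_lagS (ρ : ℕ → ℝ) {t a : ℕ} (v : ℕ) (h : t ≤ a) :
    corrSum ρ (Finset.Icc 1 t) (Finset.Icc (a + 1) v) = lagS ρ t v (a + 1 - t) := by
  rw [corrSum_Icc_succ ρ h, lagS, Nat.add_sub_cancel' (by omega : t ≤ a + 1)]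

lemma corrSum_eq_shiftR (ρ : ℕ → ℝ) (t v : ℕ) :
    corrSum ρ (Finset.Icc 1 t) (Finset.Icc (t + 1) v) = shiftR ρ t v :=
  corrSum_Icc_succ ρ le_rfl

lemma corrSum_Icc (ρ : ℕ → ℝ) {t v : ℕ} (h : t ≤ v) :
    corrSum ρ (Finset.Icc 1 t) (Finset.Icc 1 v) = cumR ρ t + shiftR ρ t v := by
  rw [← corrSum_self, ← corrSum_eq_shiftR]
  simp only [corrSum, sum_Icc_succ_eq_sub _ h, ← Finset.sum_add_distrib]
  exact Finset.sum_congr rfl fun q _ => by ring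

/-- The times up to `t` in the regime (before or after the change) that `t` belongs to. -/
def segment (τ t : ℕ) : Finset ℕ := if t ≤ τ then Finset.Icc 1 t else Finset.Icc (τ + 1) t

/-- All times in the regime that `t` belongs to. -/
def regime (T τ t : ℕ) : Finset ℕ := if t ≤ τ then Finset.Icc 1 τ else Finset.Icc (τ + 1) T

/-- The fraction of its regime elapsed at time `t`. -/
noncomputable def elapsed (T τ t : ℕ) : ℝ :=
  if t ≤ τ then (t : ℝ) / τ else ((t : ℝ) - τ) / ((T : ℝ) - τ)

/-- The partial sums of residuals are bridges within the two regimes. -/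
lemma cumResid_eq {T : ℕ} (τ : Time T) (x : Time T → ℝ) (t : Time T) :
    cumResid τ x t = ∑ q ∈ segment τ t, obs x q - elapsed T τ t * ∑ q ∈ regime T τ t, obs x q := by
  have hτ := Finset.mem_Icc.1 τ.2
  have ht := Finset.mem_Icc.1 t.2
  have hlow : ∀ s ≤ (τ : ℕ), ∑ q ∈ Finset.Icc 1 s, obs (rowResid τ x) q
      = ∑ q ∈ Finset.Icc 1 s, obs x q - s * headMean x τ := fun s hs => by
    have e : ∀ q ∈ Finset.Icc 1 s, obs (rowResid τ x) q = obs x q - headMean x τ := fun q hq => by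
      have hq' := Finset.mem_Icc.1 hq
      have hm : q ∈ Finset.Icc 1 T := Finset.mem_Icc.2 (by omega)
      rw [obs_of_mem _ hm, obs_of_mem _ hm, rowResid, if_pos]
      exact Subtype.coe_le_coe.1 (hq'.2.trans hs)
    rw [Finset.sum_congr rfl e, Finset.sum_sub_distrib]
    simp
  have h0 : ((τ : ℕ) : ℝ) ≠ 0 := by
    have : (τ : ℕ) ≠ 0 := by omega
    exact_mod_cast this
  rw [cumResid, cumSumL_apply, segment, regime, elapsed]
  split_ifs with h
  · rw [hlow t h, headMean]
    field_simp
  · have hmid : ∑ q ∈ Finset.Icc ((τ : ℕ) + 1) t, obs (rowResid τ x) q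
        = ∑ q ∈ Finset.Icc ((τ : ℕ) + 1) t, obs x q - ((t : ℝ) - (τ : ℕ)) * tailMean x τ := by
      have e : ∀ q ∈ Finset.Icc ((τ : ℕ) + 1) t,
          obs (rowResid τ x) q = obs x q - tailMean x τ := fun q hq => by
        have hq' := Finset.mem_Icc.1 hq
        have hm : q ∈ Finset.Icc 1 T := Finset.mem_Icc.2 (by omega)
        rw [obs_of_mem _ hm, obs_of_mem _ hm, rowResid, if_neg]
        exact fun hle => absurd (Subtype.coe_le_coe.2 hle) (by simpa using hq'.1)
      rw [Finset.sum_congr rfl e, Finset.sum_sub_distrib]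
      simp [Nat.cast_sub (not_le.1 h).le]
    -- The residuals up to the change add up to `0`.
    have hsplit := sum_Icc_succ_eq_sub (obs (rowResid τ x)) (not_le.1 h).le
    have hz := hlow τ le_rfl
    rw [headMean] at hz
    have hz' : ∑ q ∈ Finset.Icc 1 (τ : ℕ), obs (rowResid τ x) q = 0 := by
      rw [hz]
      field_simp
      ring
    rw [hmid, hz', sub_zero] at hsplit
    rw [← hsplit, tailMean]
    ring

/-- The covariance of the partial sums of residuals at `t` and `v`. -/
noncomputable def bridgeCov (ρ : ℕ → ℝ) (T τ t v : ℕ) : ℝ :=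
  corrSum ρ (segment τ t) (segment τ v)
    - elapsed T τ v * corrSum ρ (segment τ t) (regime T τ v)
    - elapsed T τ t * corrSum ρ (regime T τ t) (segment τ v)
    + elapsed T τ t * elapsed T τ v * corrSum ρ (regime T τ t) (regime T τ v)

lemma bridgeCov_comm (ρ : ℕ → ℝ) (T τ t v : ℕ) : bridgeCov ρ T τ t v = bridgeCov ρ T τ v t := by
  unfold bridgeCov
  rw [corrSum_comm ρ (segment τ t), corrSum_comm ρ (segment τ t), corrSum_comm ρ (regime T τ t),
    corrSum_comm ρ (regime T τ t)]
  ring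

lemma bridgeCov_left_eq_zero (ρ : ℕ → ℝ) (T : ℕ) {τ : ℕ} (hτ : τ ≠ 0) (v : ℕ) :
    bridgeCov ρ T τ τ v = 0 := by
  have : (τ : ℝ) ≠ 0 := by exact_mod_cast hτ
  simp only [bridgeCov, segment, regime, elapsed, le_refl, if_true, div_self this]
  ring

lemma bridgeCov_of_lt (ρ : ℕ → ℝ) (T : ℕ) {τ t v : ℕ} (htv : t ≤ v) (hv : v < τ) :
    bridgeCov ρ T τ t v =
      cumR ρ t + shiftR ρ t v + (t : ℝ) * v / (τ : ℝ) ^ 2 * cumR ρ τ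
      - (v : ℝ) / τ * (cumR ρ t + shiftR ρ t τ)
      - (t : ℝ) / τ * (cumR ρ v + shiftR ρ v τ) := by
  simp only [bridgeCov, segment, regime, elapsed, if_pos hv.le, if_pos (htv.trans hv.le)]
  rw [corrSum_comm ρ (Finset.Icc 1 τ) (Finset.Icc 1 v), corrSum_Icc ρ htv,
    corrSum_Icc ρ (htv.trans hv.le), corrSum_Icc ρ hv.le, corrSum_self]
  ring

lemma bridgeCov_of_lt_of_lt (ρ : ℕ → ℝ) (T : ℕ) {τ t v : ℕ} (ht : t < τ) (hv : τ < v) :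
    bridgeCov ρ T τ t v = lagS ρ t v (τ + 1 - t)
      + (t : ℝ) * ((v : ℝ) - τ) / ((τ : ℝ) * ((T : ℝ) - τ)) * shiftR ρ τ T
      - ((v : ℝ) - τ) / ((T : ℝ) - τ) * lagS ρ t T (τ + 1 - t)
      - (t : ℝ) / τ * shiftR ρ τ v := by
  simp only [bridgeCov, segment, regime, elapsed, if_pos ht.le, if_neg (not_le.2 hv)]
  rw [corrSum_eq_lagS ρ v ht.le, corrSum_eq_lagS ρ T ht.le, corrSum_eq_shiftR, corrSum_eq_shiftR,
    div_mul_div_comm]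
  ring

lemma bridgeCov_of_gt (ρ : ℕ → ℝ) {T τ t v : ℕ} (ht : τ < t) (htv : t ≤ v) (hv : v ≤ T) :
    bridgeCov ρ T τ t v = cumR ρ (t - τ) + shiftR ρ (t - τ) (v - τ)
      + ((t : ℝ) - τ) * ((v : ℝ) - τ) / ((T : ℝ) - τ) ^ 2 * cumR ρ (T - τ)
      - ((v : ℝ) - τ) / ((T : ℝ) - τ) * (cumR ρ (t - τ) + shiftR ρ (t - τ) (T - τ))
      - ((t : ℝ) - τ) / ((T : ℝ) - τ) * (cumR ρ (v - τ) + shiftR ρ (v - τ) (T - τ)) := by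
  have e : ∀ s, τ < s → Finset.Icc (τ + 1) s = Finset.Icc (τ + 1) (τ + (s - τ)) := fun s hs => by
    rw [Nat.add_sub_cancel' hs.le]
  simp only [bridgeCov, segment, regime, elapsed, if_neg (not_le.2 ht),
    if_neg (not_le.2 (ht.trans_le htv))]
  rw [e t ht, e v (ht.trans_le htv), e T (by omega)]
  simp only [corrSum_shift]
  rw [corrSum_comm ρ (Finset.Icc 1 (T - τ)) (Finset.Icc 1 (v - τ)),
    corrSum_Icc ρ (show t - τ ≤ v - τ by omega), corrSum_Icc ρ (show t - τ ≤ T - τ by omega),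
    corrSum_Icc ρ (show v - τ ≤ T - τ by omega), corrSum_self]
  generalize (T : ℝ) - τ = D
  ring

lemma gammaDiag_eq_bridgeCov (ρ : ℕ → ℝ) {T τ t : ℕ} (hτ : τ ≠ 0) (ht : t ≤ T) :
    gammaDiag ρ T τ t = bridgeCov ρ T τ t t := by
  have h0 : ∀ s, shiftR ρ s s = 0 := fun s => by simp [shiftR]
  unfold gammaDiag
  split_ifs with h1 h2
  · rw [bridgeCov_of_lt ρ T le_rfl h1, h0]
    ring
  · rw [h2, bridgeCov_left_eq_zero ρ T hτ]
  · rw [bridgeCov_of_gt ρ (by omega) le_rfl ht, h0]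
    ring

lemma gammaOff_eq_bridgeCov (ρ : ℕ → ℝ) {T τ t v : ℕ} (hτ : τ ≠ 0) (htv : t < v) (hv : v ≤ T) :
    gammaOff ρ T τ t v = bridgeCov ρ T τ t v := by
  unfold gammaOff
  split_ifs with h1 h2 h3
  · rcases h1 with rfl | rfl
    · rw [bridgeCov_left_eq_zero ρ T hτ]
    · rw [bridgeCov_comm, bridgeCov_left_eq_zero ρ T hτ]
  · rw [bridgeCov_of_lt ρ T htv.le h2]
  · rw [bridgeCov_of_lt_of_lt ρ T h3 (by omega)]
  · rw [bridgeCov_of_gt ρ (by omega) htv.le hv]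

lemma gammaMatrix_eq_bridgeCov {T : ℕ} (ρ : ℕ → ℝ) (τ t v : Time T) :
    gammaMatrix ρ τ t v = bridgeCov ρ T τ t v := by
  have hτ : (τ : ℕ) ≠ 0 := by
    have := Finset.mem_Icc.1 τ.2
    omega
  rw [gammaMatrix, Matrix.of_apply]
  split_ifs with h1 h2
  · rw [← h1]
    exact gammaDiag_eq_bridgeCov ρ hτ (Finset.mem_Icc.1 t.2).2
  · exact gammaOff_eq_bridgeCov ρ hτ (Subtype.coe_lt_coe.2 h2) (Finset.mem_Icc.1 v.2).2
  · rw [bridgeCov_comm]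
    refine gammaOff_eq_bridgeCov ρ hτ (Subtype.coe_lt_coe.2 ?_) (Finset.mem_Icc.1 t.2).2
    exact lt_of_le_of_ne (not_lt.1 h2) (Ne.symm h1)

/-! ### Moments of the partial sums of residuals -/

section Moments

variable {Ω : Type*} [MeasurableSpace Ω] {P : Measure Ω} {T : ℕ} {ε : ℕ → Ω → Time T → ℝ}
  {ρ : ℕ → ℝ}

/-- The strong law of large numbers for a function of the error vectors. -/
lemma ae_tendsto_avg (hε : IsErrorArray P ε ρ) {φ : (Time T → ℝ) → ℝ} (hφ : Measurable φ)
    (hint : Integrable (fun ω => φ (ε 0 ω)) P) :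
    ∀ᵐ ω ∂P, Tendsto (fun n => avg n fun k => φ (ε k ω)) atTop (𝓝 (∫ ω, φ (ε 0 ω) ∂P)) := by
  have h := strong_law_ae_real (fun k ω => φ (ε k ω)) hint
    (fun i j hij => (hε.indep.indepFun hij).comp hφ hφ)
    (fun i => (hε.identDistrib i).comp hφ)
  filter_upwards [h] with ω hω
  refine hω.congr fun n => ?_
  rw [avg, Fin.sum_univ_eq_sum_range (fun k => φ (ε k ω)), div_eq_inv_mul]

lemma memLp_four_obs (hε : IsErrorArray P ε ρ)
    (hfour : ∀ t, Integrable (fun ω => ε 0 ω t ^ 4) P) (q : ℕ) :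
    MemLp (fun ω => obs (ε 0 ω) q) 4 P := by
  unfold obs
  split_ifs with h
  · have hm : Measurable fun ω => ε 0 ω ⟨q, h⟩ := (measurable_pi_apply _).comp (hε.measurable 0)
    rw [← integrable_norm_rpow_iff hm.aestronglyMeasurable (by norm_num) (by norm_num)]
    refine (hfour ⟨q, h⟩).congr (Eventually.of_forall fun ω => ?_)
    have : (4 : ℝ≥0∞).toReal = ((4 : ℕ) : ℝ) := by norm_num
    rw [this]
    simp only [Real.rpow_natCast, Real.norm_eq_abs]
    rw [show (4 : ℕ) = 2 * 2 by norm_num, pow_mul, pow_mul, sq_abs]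
  · exact MemLp.zero'

lemma integral_bilinear_expansion {f₁ f₂ f₃ f₄ : Ω → ℝ} {a b c : ℝ} (h₁ : Integrable f₁ P)
    (h₂ : Integrable f₂ P) (h₃ : Integrable f₃ P) (h₄ : Integrable f₄ P) :
    ∫ ω, f₁ ω - a * f₂ ω - b * f₃ ω + c * f₄ ω ∂P
      = ∫ ω, f₁ ω ∂P - a * ∫ ω, f₂ ω ∂P - b * ∫ ω, f₃ ω ∂P + c * ∫ ω, f₄ ω ∂P := by
  have g₁ : Integrable (fun ω => f₁ ω - a * f₂ ω) P := h₁.sub (h₂.const_mul a)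
  have g₂ : Integrable (fun ω => f₁ ω - a * f₂ ω - b * f₃ ω) P := g₁.sub (h₃.const_mul b)
  rw [integral_add g₂ (h₄.const_mul c), integral_sub g₁ (h₃.const_mul b),
    integral_sub h₁ (h₂.const_mul a)]
  simp only [integral_const_mul]

lemma memLp_four_sum_obs (hε : IsErrorArray P ε ρ)
    (hfour : ∀ t, Integrable (fun ω => ε 0 ω t ^ 4) P) (A : Finset ℕ) :
    MemLp (fun ω => ∑ q ∈ A, obs (ε 0 ω) q) 4 P :=
  memLp_finsetSum A fun q _ => memLp_four_obs hε hfour q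

lemma memLp_four_cumResid (hε : IsErrorArray P ε ρ)
    (hfour : ∀ t, Integrable (fun ω => ε 0 ω t ^ 4) P) (τ t : Time T) :
    MemLp (fun ω => cumResid τ (ε 0 ω) t) 4 P := by
  simp only [cumResid_eq]
  exact (memLp_four_sum_obs hε hfour _).sub ((memLp_four_sum_obs hε hfour _).const_mul _)

lemma memLp_four_linear_cumResid (hε : IsErrorArray P ε ρ)
    (hfour : ∀ t, Integrable (fun ω => ε 0 ω t ^ 4) P) (τ : Time T) (u : Time T → ℝ) :
    MemLp (fun ω => ∑ t, u t * cumResid τ (ε 0 ω) t) 4 P :=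
  memLp_finsetSum _ fun t _ => (memLp_four_cumResid hε hfour τ t).const_mul _

variable [IsProbabilityMeasure P]

lemma integrable_mul_of_memLp_four {X Y : Ω → ℝ} (hX : MemLp X 4 P) (hY : MemLp Y 4 P) :
    Integrable (fun ω => X ω * Y ω) P :=
  (hX.mono_exponent (p := 2) (by norm_num)).integrable_mul
    (hY.mono_exponent (p := 2) (by norm_num))

lemma integral_obs_mul_obs (hε : IsErrorArray P ε ρ)
    (hfour : ∀ t, Integrable (fun ω => ε 0 ω t ^ 4) P) {q u : ℕ} (hq : q ∈ Finset.Icc 1 T)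
    (hu : u ∈ Finset.Icc 1 T) :
    ∫ ω, obs (ε 0 ω) q * obs (ε 0 ω) u ∂P = ρ ((q : ℤ) - u).natAbs := by
  have key : ∀ {q u : ℕ} (_ : q ∈ Finset.Icc 1 T) (_ : u ∈ Finset.Icc 1 T), q ≤ u →
      ∫ ω, obs (ε 0 ω) q * obs (ε 0 ω) u ∂P = ρ ((q : ℤ) - u).natAbs := fun {q u} hq hu h => by
    have hL2 : ∀ s, MemLp (fun ω => obs (ε 0 ω) s) 2 P := fun s =>
      (memLp_four_obs hε hfour s).mono_exponent (by norm_num)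
    have hcov := covariance_eq_sub (hL2 q) (hL2 u)
    have h1 : cov[fun ω => obs (ε 0 ω) q, fun ω => obs (ε 0 ω) u; P] = ρ (u - q) := by
      simp only [obs_of_mem _ hq, obs_of_mem _ hu]
      exact hε.cov_eq 0 ⟨q, hq⟩ ⟨u, hu⟩ h
    have h2 : ∫ ω, obs (ε 0 ω) q ∂P = 0 := by
      simp only [obs_of_mem _ hq]
      exact hε.mean_zero 0 _
    rw [h1, h2, zero_mul, sub_zero] at hcov
    rw [show ((q : ℤ) - u).natAbs = u - q by omega, hcov]
    rfl
  rcases le_total q u with h | h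
  · exact key hq hu h
  · rw [← Int.natAbs_neg, neg_sub, ← key hu hq h]
    simp only [mul_comm]

lemma integral_sum_obs_mul_sum_obs (hε : IsErrorArray P ε ρ)
    (hfour : ∀ t, Integrable (fun ω => ε 0 ω t ^ 4) P) {A B : Finset ℕ}
    (hA : A ⊆ Finset.Icc 1 T) (hB : B ⊆ Finset.Icc 1 T) :
    ∫ ω, (∑ q ∈ A, obs (ε 0 ω) q) * (∑ u ∈ B, obs (ε 0 ω) u) ∂P = corrSum ρ A B := by
  have hi : ∀ q u, Integrable (fun ω => obs (ε 0 ω) q * obs (ε 0 ω) u) P := fun q u =>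
    integrable_mul_of_memLp_four (memLp_four_obs hε hfour q) (memLp_four_obs hε hfour u)
  simp only [Finset.sum_mul_sum]
  rw [integral_finsetSum _ fun q _ => integrable_finsetSum _ fun u _ => hi q u, corrSum]
  refine Finset.sum_congr rfl fun q hq => ?_
  rw [integral_finsetSum _ fun u _ => hi q u]
  exact Finset.sum_congr rfl fun u hu => integral_obs_mul_obs hε hfour (hA hq) (hB hu)

lemma segment_subset (τ t : Time T) : segment τ t ⊆ Finset.Icc 1 T := by
  have := Finset.mem_Icc.1 t.2
  intro q
  unfold segment
  split_ifs <;> simp only [Finset.mem_Icc] <;> omega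

lemma regime_subset (τ : Time T) (t : ℕ) : regime T τ t ⊆ Finset.Icc 1 T := by
  have := Finset.mem_Icc.1 τ.2
  intro q
  unfold regime
  split_ifs <;> simp only [Finset.mem_Icc] <;> omega

lemma integral_cumResid (hε : IsErrorArray P ε ρ)
    (hfour : ∀ t, Integrable (fun ω => ε 0 ω t ^ 4) P) (τ t : Time T) :
    ∫ ω, cumResid τ (ε 0 ω) t ∂P = 0 := by
  have hi : ∀ q, Integrable (fun ω => obs (ε 0 ω) q) P := fun q =>
    (memLp_four_obs hε hfour q).integrable (by norm_num)
  have h0 : ∀ q, ∫ ω, obs (ε 0 ω) q ∂P = 0 := fun q => by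
    unfold obs
    split_ifs with h
    · exact hε.mean_zero 0 _
    · exact integral_zero _ _
  simp only [cumResid_eq]
  rw [integral_sub (integrable_finsetSum _ fun q _ => hi q)
    ((integrable_finsetSum _ fun q _ => hi q).const_mul _), integral_const_mul,
    integral_finsetSum _ fun q _ => hi q, integral_finsetSum _ fun q _ => hi q]
  simp [h0]

/-- `Γ(τ)` is the covariance matrix of the partial sums of residuals of a row of errors. -/
lemma integral_cumResid_mul_cumResid (hε : IsErrorArray P ε ρ)
    (hfour : ∀ t, Integrable (fun ω => ε 0 ω t ^ 4) P) (τ t v : Time T) :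
    ∫ ω, cumResid τ (ε 0 ω) t * cumResid τ (ε 0 ω) v ∂P = gammaMatrix ρ τ t v := by
  have hi : ∀ A B : Finset ℕ, Integrable (fun ω =>
      (∑ q ∈ A, obs (ε 0 ω) q) * (∑ u ∈ B, obs (ε 0 ω) u)) P := fun A B =>
    integrable_mul_of_memLp_four (memLp_four_sum_obs hε hfour A) (memLp_four_sum_obs hε hfour B)
  have e : ∀ ω, cumResid τ (ε 0 ω) t * cumResid τ (ε 0 ω) v
      = (∑ q ∈ segment τ t, obs (ε 0 ω) q) * (∑ u ∈ segment τ v, obs (ε 0 ω) u)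
        - elapsed T τ v *
          ((∑ q ∈ segment τ t, obs (ε 0 ω) q) * (∑ u ∈ regime T τ v, obs (ε 0 ω) u))
        - elapsed T τ t *
          ((∑ q ∈ regime T τ t, obs (ε 0 ω) q) * (∑ u ∈ segment τ v, obs (ε 0 ω) u))
        + elapsed T τ t * elapsed T τ v *
          ((∑ q ∈ regime T τ t, obs (ε 0 ω) q) * (∑ u ∈ regime T τ v, obs (ε 0 ω) u)) :=
    fun ω => by rw [cumResid_eq, cumResid_eq]; ring
  rw [gammaMatrix_eq_bridgeCov, integral_congr_ae (Eventually.of_forall e),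
    integral_bilinear_expansion (hi _ _) (hi _ _) (hi _ _) (hi _ _), bridgeCov]
  have hs := segment_subset (T := T) τ
  have hr := regime_subset (T := T) τ
  rw [integral_sum_obs_mul_sum_obs hε hfour (hs t) (hs v),
    integral_sum_obs_mul_sum_obs hε hfour (hs t) (hr v),
    integral_sum_obs_mul_sum_obs hε hfour (hr t) (hs v),
    integral_sum_obs_mul_sum_obs hε hfour (hr t) (hr v)]

lemma integral_sq_linear_cumResid (hε : IsErrorArray P ε ρ)
    (hfour : ∀ t, Integrable (fun ω => ε 0 ω t ^ 4) P) (τ : Time T) (u : Time T → ℝ) :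
    ∫ ω, (∑ t, u t * cumResid τ (ε 0 ω) t) ^ 2 ∂P = u ⬝ᵥ (gammaMatrix ρ τ).mulVec u := by
  have hi : ∀ t v, Integrable (fun ω =>
      (u t * u v) * (cumResid τ (ε 0 ω) t * cumResid τ (ε 0 ω) v)) P := fun t v =>
    (integrable_mul_of_memLp_four (memLp_four_cumResid hε hfour τ t)
      (memLp_four_cumResid hε hfour τ v)).const_mul _
  have e : ∀ ω, (∑ t, u t * cumResid τ (ε 0 ω) t) ^ 2
      = ∑ t, ∑ v, (u t * u v) * (cumResid τ (ε 0 ω) t * cumResid τ (ε 0 ω) v) := fun ω => by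
    rw [sq, Finset.sum_mul_sum]
    exact Finset.sum_congr rfl fun t _ => Finset.sum_congr rfl fun v _ => by ring
  simp only [e]
  rw [integral_finsetSum _ fun t _ => integrable_finsetSum _ fun v _ => hi t v]
  simp only [dotProduct, Matrix.mulVec, Finset.mul_sum]
  refine Finset.sum_congr rfl fun t _ => ?_
  rw [integral_finsetSum _ fun v _ => hi t v]
  refine Finset.sum_congr rfl fun v _ => ?_
  rw [integral_const_mul, integral_cumResid_mul_cumResid hε hfour]
  ring

lemma posSemidef_gammaMatrix (hε : IsErrorArray P ε ρ)
    (hfour : ∀ t, Integrable (fun ω => ε 0 ω t ^ 4) P) (τ : Time T) :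
    (gammaMatrix ρ τ).PosSemidef := by
  refine Matrix.PosSemidef.of_dotProduct_mulVec_nonneg ?_ fun u => ?_
  · ext t v
    rw [Matrix.conjTranspose_apply, star_trivial, gammaMatrix_eq_bridgeCov,
      gammaMatrix_eq_bridgeCov, bridgeCov_comm]
  · rw [star_trivial, ← integral_sq_linear_cumResid hε hfour τ u]
    exact integral_nonneg fun ω => sq_nonneg _

/-- A denominator functional whose variance is `0` vanishes almost surely at every row. -/
lemma ae_tailDev_cumResid_eq_zero (hε : IsErrorArray P ε ρ)
    (hfour : ∀ t, Integrable (fun ω => ε 0 ω t ^ 4) P) (τ : Time T) {t s : ℕ}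
    (h : tailVar (gammaMatrix ρ τ) t s = 0) (k : ℕ) :
    ∀ᵐ ω ∂P, tailDev t s (cumResid τ (ε k ω)) = 0 := by
  have hmeas : Measurable fun x : Time T → ℝ => tailDev t s (cumResid τ x) :=
    (continuous_tailDev t s).measurable.comp (measurable_cumResid τ)
  have hzero : ∀ᵐ ω ∂P, tailDev t s (cumResid τ (ε 0 ω)) = 0 := by
    have h0 := integral_sq_linear_cumResid hε hfour τ (tailCoeff T t s)
    rw [show _ ⬝ᵥ _ = tailVar (gammaMatrix ρ τ) t s from rfl, h] at h0
    have hint : Integrable (fun ω => (∑ q, tailCoeff T t s q * cumResid τ (ε 0 ω) q) ^ 2) P := by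
      have hL := memLp_four_linear_cumResid hε hfour τ (tailCoeff T t s)
      simpa only [sq] using integrable_mul_of_memLp_four hL hL
    rw [integral_eq_zero_iff_of_nonneg (fun ω => sq_nonneg _) hint] at h0
    filter_upwards [h0] with ω hω
    rw [tailDev_eq_sum]
    exact pow_eq_zero_iff two_ne_zero |>.1 hω
  exact (hε.identDistrib k).symm.ae_snd
    (p := fun x => tailDev t s (cumResid τ x) = 0) (hmeas (measurableSet_singleton 0)) hzero

/-- With the true change point in place of its estimator, the conditional expectations of functions
of the bootstrap statistic converge almost surely. -/
theorem ae_tendsto_integral_ratioStat (hε : IsErrorArray P ε ρ)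
    (hfour : ∀ t, Integrable (fun ω => ε 0 ω t ^ 4) P) (μ : ℕ → ℝ) (δ : ℕ → ℕ → ℝ) {σ : ℝ}
    (hσ : 0 < σ) (τ : Time T) (f : ℝ →ᵇ ℝ) :
    ∀ᵐ ω ∂P, Tendsto (fun N => ∫ j, f (ratioStat (bootPanel
        (residual τ (panelData μ (δ N) σ τ ε N ω)) j)) ∂labelLaw N) atTop
      (𝓝 (∫ x, f x ∂limitLaw ρ τ)) := by
  have hΓ := posSemidef_gammaMatrix hε hfour τ
  have hcoord : ∀ t, Measurable fun x : Time T → ℝ => cumResid τ x t := fun t =>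
    (measurable_pi_apply t).comp (measurable_cumResid τ)
  have h1 : ∀ t, ∀ᵐ ω ∂P,
      Tendsto (fun n => avg n fun k => cumResid τ (ε k ω) t) atTop (𝓝 0) := fun t => by
    have h := ae_tendsto_avg hε (hcoord t)
      ((memLp_four_cumResid hε hfour τ t).integrable (by norm_num))
    rwa [integral_cumResid hε hfour τ t] at h
  have h2 : ∀ t v, ∀ᵐ ω ∂P, Tendsto (fun n => avg n fun k =>
      cumResid τ (ε k ω) t * cumResid τ (ε k ω) v) atTop (𝓝 (gammaMatrix ρ τ t v)) :=
    fun t v => by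
      have h := ae_tendsto_avg (φ := fun x => cumResid τ x t * cumResid τ x v) hε
        ((hcoord t).mul (hcoord v)) (integrable_mul_of_memLp_four
          (memLp_four_cumResid hε hfour τ t) (memLp_four_cumResid hε hfour τ v))
      rwa [integral_cumResid_mul_cumResid hε hfour τ t v] at h
  have h4 : ∀ t, ∀ᵐ ω ∂P, ∃ κ, Tendsto (fun n => avg n fun k =>
      cumResid τ (ε k ω) t ^ 4) atTop (𝓝 κ) := fun t => by
    have hint : Integrable (fun ω => cumResid τ (ε 0 ω) t ^ 4) P := by
      have h := (memLp_four_cumResid hε hfour τ t).integrable_norm_pow (p := 4) (by norm_num)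
      refine h.congr (Eventually.of_forall fun ω => ?_)
      simp only [Real.norm_eq_abs]
      rw [show (4 : ℕ) = 2 * 2 by norm_num, pow_mul, pow_mul, sq_abs]
    filter_upwards [ae_tendsto_avg (φ := fun x => cumResid τ x t ^ 4) hε
      ((hcoord t).pow_const 4) hint] with ω hω using ⟨_, hω⟩
  have h0 : ∀ t s k : ℕ, ∀ᵐ ω ∂P, tailVar (gammaMatrix ρ τ) t s = 0 →
      tailDev t s (cumResid τ (ε k ω)) = 0 := fun t s k => by
    by_cases h : tailVar (gammaMatrix ρ τ) t s = 0
    · filter_upwards [ae_tailDev_cumResid_eq_zero hε hfour τ h k] with ω hω _ using hω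
    · exact Eventually.of_forall fun ω h' => absurd h' h
  filter_upwards [ae_all_iff.2 h1, ae_all_iff.2 fun t => ae_all_iff.2 (h2 t), ae_all_iff.2 h4,
    ae_all_iff.2 fun t => ae_all_iff.2 fun s => ae_all_iff.2 (h0 t s)] with ω g1 g2 g4 g0
  have hmain := tendsto_integral_limitFunctional_bootSum (w := fun k => cumResid τ (ε k ω)) hΓ
    g1 g2 g4 (fun t s h k => g0 t s k h) f
  have hlim : ∫ x, f x ∂limitLaw ρ τ = ∫ x : EuclideanSpace ℝ (Time T),
      f (limitFunctional fun t => x t) ∂multivariateGaussian 0 (gammaMatrix ρ τ) := by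
    have hm : Measurable fun x : EuclideanSpace ℝ (Time T) => limitFunctional fun t => x t :=
      measurable_limitFunctional.comp (by fun_prop)
    rw [limitLaw, integral_map hm.aemeasurable f.continuous.aestronglyMeasurable]
  rw [hlim]
  refine hmain.congr' ?_
  filter_upwards [eventually_ne_atTop 0] with N hN
  simp only [ratioStat_bootPanel μ (δ N) hσ τ ε hN ω]

end Moments

end PanelChange

open PanelChange in
theorem theorem4 {Ω : Type*} [MeasurableSpace Ω] (P : Measure Ω) [IsProbabilityMeasure P]
    (T : ℕ) (hT : 4 ≤ T) (τ : PanelChange.Time T)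
    (μ : ℕ → ℝ) (δ : ℕ → ℕ → ℝ) (σ : ℝ) (hσ : 0 < σ)
    (ε : ℕ → Ω → PanelChange.Time T → ℝ) (ρ : ℕ → ℝ)
    (hε : PanelChange.IsErrorArray P ε ρ)
    (hfour : ∀ t, Integrable (fun ω => ε 0 ω t ^ 4) P)
    (tauHat : ∀ N, PanelChange.Panel N T → PanelChange.Time T)
    (htauHat : ∀ N, Measurable (tauHat N))
    (hconsistent : Tendsto
      (fun N => P {ω | tauHat N (PanelChange.panelData μ (δ N) σ τ ε N ω) = τ}) atTop (𝓝 1))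
    (J : ∀ N, Ω → Fin N → Fin N)
    (hJ : ∀ N, PanelChange.IsResampling P (PanelChange.panelData μ (δ N) σ τ ε N) (J N)) :
    (PanelChange.gammaMatrix ρ τ).PosSemidef ∧
      PanelChange.CondTendstoInDistribution P
        (fun N ω => PanelChange.bootStat (tauHat N)
          (PanelChange.panelData μ (δ N) σ τ ε N ω) (J N ω))
        (fun N => PanelChange.panelData μ (δ N) σ τ ε N)
        (PanelChange.limitLaw ρ τ) := by
  refine ⟨posSemidef_gammaMatrix hε hfour τ, fun f => ?_⟩
  set Y : ∀ N, Ω → Panel N T := fun N => panelData μ (δ N) σ τ ε N with hYdef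
  have hY : ∀ N, Measurable (Y N) := fun N => measurable_panelData μ (δ N) σ τ hε.measurable N
  set c : ℝ := ∫ x, f x ∂limitLaw ρ τ
  set oracle : ℕ → Ω → ℝ := fun N ω =>
    ∫ j, f (ratioStat (bootPanel (residual τ (Y N ω)) j)) ∂labelLaw N with horacle
  have horacle_meas : ∀ N, AEStronglyMeasurable (oracle N) P := fun N => by
    have hj : Measurable fun p : Panel N T × (Fin N → Fin N) =>
        ratioStat (bootPanel (residual τ p.1) p.2) := by
      apply measurable_from_prod_countable_left
      intro j
      exact measurable_ratioStat_bootPanel τ j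
    have hs : StronglyMeasurable fun p : Panel N T × (Fin N → Fin N) =>
        f (ratioStat (bootPanel (residual τ p.1) p.2)) :=
      (f.continuous.measurable.comp hj).stronglyMeasurable
    exact (hs.integral_prod_right'.comp_measurable (hY N)).aestronglyMeasurable
  have horacle_lim : TendstoInMeasure P oracle atTop fun _ => c :=
    tendstoInMeasure_of_tendsto_ae horacle_meas
      (ae_tendsto_integral_ratioStat hε hfour μ δ hσ τ f)
  have hcond : ∀ N, ∀ᵐ ω ∂P,
      ∫ x, f x ∂(condDistrib (fun ω => bootStat (tauHat N) (Y N ω) (J N ω)) (Y N) P (Y N ω))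
        = ∫ j, f (bootStat (tauHat N) (Y N ω) j) ∂labelLaw N := fun N => by
    rw [← map_labels_eq_labelLaw (hJ N)]
    exact integral_condDistrib_of_indepFun (hY N) (hJ N).measurable (hJ N).indep_data
      (measurable_bootStat (htauHat N)) f
  have hwrong : Tendsto (fun N => P {ω | tauHat N (Y N ω) = τ}ᶜ) atTop (𝓝 0) := by
    have hset : ∀ N, MeasurableSet {ω | tauHat N (Y N ω) = τ} := fun N =>
      ((htauHat N).comp (hY N)) (measurableSet_singleton τ)
    have : Tendsto (fun N => 1 - P {ω | tauHat N (Y N ω) = τ}) atTop (𝓝 (1 - 1)) :=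
      ENNReal.Tendsto.sub tendsto_const_nhds hconsistent (Or.inl ENNReal.one_ne_top)
    rw [tsub_self] at this
    refine this.congr fun N => ?_
    rw [measure_compl (hset N) (measure_ne_top _ _), measure_univ]
  intro η hη
  have hbound : Tendsto (fun N => P {ω | η ≤ edist (oracle N ω) c}
      + P {ω | tauHat N (Y N ω) = τ}ᶜ) atTop (𝓝 0) := by
    simpa using (horacle_lim η hη).add hwrong
  refine tendsto_of_tendsto_of_tendsto_of_le_of_le tendsto_const_nhds hbound
    (fun _ => zero_le) fun N => ?_
  refine (measure_mono_ae ?_).trans (measure_union_le _ _)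
  filter_upwards [hcond N] with ω hω hmem
  by_cases hτ : tauHat N (Y N ω) = τ
  · left
    change η ≤ edist (oracle N ω) c
    have e : ∫ j, f (bootStat (tauHat N) (Y N ω) j) ∂labelLaw N = oracle N ω := by
      simp only [bootStat, hτ, horacle]
    rw [← e, ← hω]
    exact hmem
  · exact Or.inr hτ
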